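/- **Setting.** Serve an online sequence of requests $\langle$Insert, name, length$\rangle$ (positive integral length, name not in use) and $\langle$Delete, name$\rangle$ (name of an active object), starting from no objects, storing the objects in an array with addresses $0,1,2,\dots$. A cost function $f$ is monotonically increasing (not necessarily strictly) and subadditive on positive integers; it is unknown to the algorithm. The cost of a request is the sum of $f(\text{length})$ over all writes of objects made while it is served: the initial placement of an inserted object and every single move of an object. $\Delta$ is the length of the longest object inserted so far (the present request included). Let $0<\epsilon'\le 1/2$. **Deamortized reallocator.** Size class $i$ consists of the lengths $w$ with $2^{i-1}\le w<2^i$. The array consists of one region per size class, in increasing order, each a payload segment followed by a buffer segment, and then a tail buffer. Initially all segments have size $0$. *Update when no flush is in progress.* An inserted object of class $i$ is written at the end of the earliest buffer $j\ge i$ with enough unoccupied space (the tail buffer counts as the last one). If all size classes $\ge i$ have payload segments of size $0$ and the tail buffer is empty, then instead a new region with payload size $w$ (holding the object) and an empty buffer of size $\lfloor\epsilon' w\rfloor$ is created just before the tail buffer. If no buffer has space, the object is written at the end of the tail buffer, exceeding it, and triggers a flush. A deleted object leaves a hole, and a dummy delete record of its size is stored in a buffer by the same first-fit rule; if it fits nowhere,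 it is not stored and a flush is triggered. *Flush.* Let $b$ be the largest number such that the triggering update and everything in the buffers $i\ge b$ (including the tail buffer, delete records and holes of deleted objects) belong to size classes $\ge b$. With $V(i)$ the volume of the remaining objects of class $i$ and $V_f$ the volume of all remaining objects at the time the flush is triggered, the new boundaries give, for each $i\ge b$, space $V(i)$ to payload segment $i$ and $\lfloor\epsilon'V(i)\rfloor$ to buffer $i$, and $\lfloor\epsilon' V_f\rfloor$ to the tail buffer; these buffers are then empty. Let $L$ and $L'$ be the endpoints of the occupied space before and of the whole structure after the flush, both minus the length of the triggering object if the trigger is an insert, let $B$ be the total size of the buffers flushed (including the tail buffer), and $M=\max\{L,L'\}+B+\Delta$. The moves are, in order: the buffered objects of the flushed buffers to consecutive addresses from $M$ on; the payload objects of classes $\ge b$, from last to first, packed so as to end at $M$; the payload objects, from first to last, to their final places; the buffered objects to the ends of their payload segments. No move is made during the triggering request. The space after this working space is the log. *Update of size $w$ when a flush is in progress.* The update (an inserted object, or a delete record) is put at the end of the log; then the next steps of the flush are performed as long as the volume processed in this request is at most $(4/\epsilon')w$ (so the last step may exceed this volume). After the moves above, the steps are to re-insert/re-delete the log entries, in order,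 each as in an update when no flush is in progress and counted with its size as volume. The flush ends when no moves and no log entries remain; if a re-inserted/re-deleted entry triggers a new flush, no further step is performed in this request (any unprocessed log entries stay in the log of the new flush). **Lemma.** There is an absolute constant $C>0$ such that for every $0<\epsilon'\le 1/2$, every monotonically increasing subadditive $f$, and every legal request sequence, whose $t$-th request inserts or deletes an object of length $w_t$: 1. (amortized cost $O(f(w)(1/\epsilon')\lg(1/\epsilon'))$) the total cost of all requests is at most $\sum_t C\, f(w_t)\,(1/\epsilon')\lg(1/\epsilon')$; 2. (worst-case cost) for each $t$, the cost of the $t$-th request is at most $C\left((1/\epsilon')\,w_t f(1)+f(\Delta)\right)$. -/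

import Mathlib

namespace StorageReallocation

universe u

variable {α : Type u} [DecidableEq α]

/-! ### Requests, active objects, cost functions -/

/-- A request: `⟨InsertObject, name, length⟩` or `⟨DeleteObject, name⟩`. -/
inductive Request (α : Type u) where
  | insert (name : α) (len : ℕ)
  | delete (name : α)

/-- The table of active objects (name ↦ length) after one more request. -/
def Request.apply (act : α → Option ℕ) : Request α → (α → Option ℕ)
  | .insert x w => Function.update act x (some w)
  | .delete x => Function.update act x none

/-- The table of active objects after a sequence of requests, starting from no objects. -/
def active (σ : List (Request α)) : α → Option ℕ :=
  σ.foldl Request.apply (fun _ => none)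

/-- The request is legal: an inserted object has positive integral length and its name is not in use;
a deleted object is active. -/
def Request.Legal (act : α → Option ℕ) : Request α → Prop
  | .insert x w => 1 ≤ w ∧ act x = none
  | .delete x => act x ≠ none

/-- An online execution all of whose requests are legal when they are issued. -/
def IsExecution (σ : List (Request α)) : Prop :=
  ∀ (t : ℕ) (ht : t < σ.length), (σ[t]).Legal (active (σ.take t))

/-- The length of the object that the request inserts or deletes. -/
def Request.len (act : α → Option ℕ) : Request α → ℕ
  | .insert _ w => w
  | .delete x => (act x).getD 0

/-- The length of the longest object inserted by a sequence of requests (`Δ`). -/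
def longest : List (Request α) → ℕ
  | [] => 0
  | .insert _ w :: σ => max w (longest σ)
  | .delete _ :: σ => longest σ

/-- Monotone subadditive cost functions on (positive, integral) lengths. -/
structure IsCostFunction (f : ℕ → ℝ) : Prop where
  mono : ∀ x y, 0 < x → x ≤ y → f x ≤ f y
  subadd : ∀ x y, 0 < x → 0 < y → f (x + y) ≤ f x + f y

/-! ### The array -/

/-- A piece of the array holding `size` consecutive addresses from `addr` on.  If `live`, it stores the
object `name`; otherwise it is the hole left by that object in a buffer, or a (dummy) delete record. -/
structure Cell (α : Type u) where
  name : α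
  size : ℕ
  addr : ℕ
  live : Bool

/-- The size class `i` of lengths `w` with `2 ^ (i - 1) ≤ w < 2 ^ i`. -/
def sizeClass (w : ℕ) : ℕ := Nat.size w

/-- Total size of a list of cells. -/
def vol (l : List (Cell α)) : ℕ := (l.map Cell.size).sum

/-- The cells that store objects. -/
def liveCells (l : List (Cell α)) : List (Cell α) := l.filter (fun c => c.live)

/-- The cells whose size belongs to size class `k`. -/
def ofClass (k : ℕ) (l : List (Cell α)) : List (Cell α) :=
  l.filter (fun c => sizeClass c.size = k)

/-- Lay the cells out contiguously, in order, from address `s` on. -/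
def layOut : ℕ → List (Cell α) → List (Cell α)
  | _, [] => []
  | s, c :: l => { c with addr := s } :: layOut (s + c.size) l

/-- The region of one size class: a payload segment of length `paySpace` followed by a buffer segment
of length `bufSpace`. The payload list holds the stored objects only (deleted ones leave holes); the
buffer list holds everything written to the buffer since its last flush. -/
structure Region (α : Type u) where
  payload : List (Cell α)
  paySpace : ℕ
  buffer : List (Cell α)
  bufSpace : ℕ

/-- The regions of the size classes, followed by the tail buffer; `maxLen` is the length `Δ` of the
longest object seen so far. -/
structure Layout (α : Type u) where
  region : ℕ → Region α
  tail : List (Cell α)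
  tailSpace : ℕ
  maxLen : ℕ

namespace Layout

/-- The size classes are `1, …, ⌊lg Δ⌋ + 1`. -/
def numClasses (D : Layout α) : ℕ := sizeClass D.maxLen

/-- The size classes `b, b + 1, …, ⌊lg Δ⌋ + 1`, in increasing order. -/
def classesFrom (D : Layout α) (b : ℕ) : List ℕ :=
  (List.range (D.numClasses + 1)).filter (fun k => b ≤ k)

/-- First address of region `i`. -/
def regionStart (D : Layout α) (i : ℕ) : ℕ :=
  ∑ j ∈ Finset.range i, ((D.region j).paySpace + (D.region j).bufSpace)

/-- First address of the tail buffer. -/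
def tailStart (D : Layout α) : ℕ := D.regionStart (D.numClasses + 1)

/-- Write a cell at the end of the earliest buffer `j ≥ sizeClass w` with enough unoccupied space, the
tail buffer being the last one; `none` if there is no such buffer.  Also returns the cell written. -/
def store (D : Layout α) (x : α) (w : ℕ) (live : Bool) : Option (Layout α × Cell α) :=
  match (D.classesFrom (sizeClass w)).find?
      (fun j => vol (D.region j).buffer + w ≤ (D.region j).bufSpace) with
  | some j =>
      let R := D.region j
      let c : Cell α := ⟨x, w, D.regionStart j + R.paySpace + vol R.buffer, live⟩
      some ({ D with region := Function.update D.region j { R with buffer := R.buffer ++ [c] } }, c)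
  | none =>
      if vol D.tail + w ≤ D.tailSpace then
        let c : Cell α := ⟨x, w, D.tailStart + vol D.tail, live⟩
        some ({ D with tail := D.tail ++ [c] }, c)
      else none

/-- Remove object `x`: it leaves a hole. -/
def remove (D : Layout α) (x : α) : Layout α :=
  let kill (c : Cell α) : Cell α := if c.name = x then { c with live := false } else c
  { D with
    region := fun k =>
      { D.region k with
        payload := (D.region k).payload.filter (fun c => c.name ≠ x)
        buffer := (D.region k).buffer.map kill }
    tail := D.tail.map kill }

/-- Move object `m.name` of a payload list to address `m.addr`. -/
def relocate (D : Layout α) (m : Cell α) : Layout α :=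
  { D with
    region := fun k =>
      { D.region k with
        payload := (D.region k).payload.map
          (fun c => if c.name = m.name then { c with addr := m.addr } else c) } }

/-- The boundary size class of a flush triggered by an update of size class `s`: the largest `b` such
that the triggering update and everything in the buffers `i ≥ b` (the tail buffer included) belong
to size classes `≥ b`. -/
def boundary (D : Layout α) (s : ℕ) : ℕ :=
  Nat.findGreatest
    (fun b => (∀ c ∈ D.tail, b ≤ sizeClass c.size) ∧
      ∀ j ∈ D.classesFrom b, ∀ c ∈ (D.region j).buffer, b ≤ sizeClass c.size) s

/-- Total volume of the objects in the regions and the tail buffer. -/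
def volume (D : Layout α) : ℕ :=
  ((D.classesFrom 0).map
    (fun k => vol (D.region k).payload + vol (liveCells (D.region k).buffer))).sum
    + vol (liveCells D.tail)

/-- The objects stored in the buffers `i ≥ b`, the tail buffer included. -/
def buffered (D : Layout α) (b : ℕ) : List (Cell α) :=
  (D.classesFrom b).flatMap (fun k => liveCells (D.region k).buffer) ++ liveCells D.tail

/-- The new segment boundaries of a flush of the size classes `≥ b`: payload segment `k` gets space
`V(k)`, buffer `k` gets space `⌊ε V(k)⌋`, the tail buffer gets `⌊ε V⌋`; all these buffers are empty.
The objects still carry the addresses they had when the flush was triggered. -/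
noncomputable def target (ε : ℝ) (D : Layout α) (b : ℕ) : Layout α :=
  { D with
    region := fun k =>
      if b ≤ k then
        let l := (D.region k).payload ++ ofClass k (D.buffered b)
        { payload := l, paySpace := vol l, buffer := [], bufSpace := ⌊ε * (vol l : ℝ)⌋₊ }
      else D.region k
    tail := []
    tailSpace := ⌊ε * (D.volume : ℝ)⌋₊ }

end Layout

/-! ### Flushes -/

/-- A flush in progress: the moves still to be made (each cell gives the object and its destination),
the part of the log that has not been re-inserted/re-deleted yet (live cells are inserted objects, the
others delete records), and the first address after the log. -/
structure Flush (α : Type u) where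
  moves : List (Cell α)
  log : List (Cell α)
  logEnd : ℕ

/-- Trigger a flush by an update of size class `s`.  For an insert of a size-`w` object, that object
is already the last one in the tail buffer of `D`; for a delete, `w = 0`.  No object is moved yet. -/
noncomputable def startFlush (ε : ℝ) (D : Layout α) (s w : ℕ) : Layout α × Flush α :=
  let b := D.boundary s
  let D' := D.target ε b
  -- space before and after the flush, without the triggering insert
  let L := D.tailStart + vol D.tail - w
  let L' := D'.tailStart + D'.tailSpace - w
  -- space of the flushed buffers
  let B := ((D.classesFrom b).map (fun k => (D.region k).bufSpace)).sum + D.tailSpace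
  let M := max L L' + B + D.maxLen
  let buf := D.buffered b
  let pay := (D.classesFrom b).flatMap (fun k => (D.region k).payload)
  -- the buffered objects go to the working space from `M` on
  let moves₁ := layOut M buf
  -- the payload objects are packed, last one first, so as to end at `M`
  let moves₂ := (layOut (M - vol pay) pay).reverse
  -- the payload objects go to their final places, first one first
  let moves₃ := (D.classesFrom b).flatMap
    (fun k => layOut (D'.regionStart k) (D.region k).payload)
  -- the buffered objects go to the ends of their payload segments
  let moves₄ := (D.classesFrom b).flatMap
    (fun k => layOut (D'.regionStart k + vol (D.region k).payload) (ofClass k buf))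
  (D', { moves := moves₁ ++ moves₂ ++ moves₃ ++ moves₄
         log := []
         logEnd := M + vol buf })

/-- Insert an object when no flush move is pending.  If its size class is larger than every existing
one (and the tail buffer is empty, so that it can be shifted), a new region is created for it, located
before the tail buffer.  Otherwise it is stored in a buffer; if no buffer has enough space it is put at
the end of the tail buffer, exceeding it, and triggers a flush.
Returns the new layout, the triggered flush if any, and the cell written. -/
noncomputable def insertObject (ε : ℝ) (D : Layout α) (x : α) (w : ℕ) :
    Layout α × Option (Flush α) × Cell α :=
  let i := sizeClass w
  if D.tail.isEmpty ∧ ∀ j ∈ D.classesFrom i, (D.region j).paySpace = 0 then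
    let c : Cell α := ⟨x, w, D.regionStart i, true⟩
    let R : Region α := ⟨[c], w, [], ⌊ε * (w : ℝ)⌋₊⟩
    ({ D with region := Function.update D.region i R }, none, c)
  else
    match D.store x w true with
    | some (D', c) => (D', none, c)
    | none =>
        let c : Cell α := ⟨x, w, D.tailStart + vol D.tail, true⟩
        let F := startFlush ε { D with tail := D.tail ++ [c] } i w
        (F.1, some F.2, c)

/-- Delete an object of size `w` when no flush move is pending: it leaves a hole, and a delete record of
size `w` is stored in a buffer; if no buffer has enough space, a flush is triggered. -/
noncomputable def deleteObject (ε : ℝ) (D : Layout α) (x : α) (w : ℕ) :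
    Layout α × Option (Flush α) :=
  match (D.remove x).store x w false with
  | some (D', _) => (D', none)
  | none =>
      let F := startFlush ε (D.remove x) (sizeClass w) 0
      (F.1, some F.2)

/-- A flush with nothing left to do is over. -/
def Flush.settle (F : Flush α) : Option (Flush α) :=
  if F.moves.isEmpty ∧ F.log.isEmpty then none else some F

/-- Carry out pending moves as long as the volume `done` processed so far does not exceed `budget`.
Returns the volume processed, the layout, the moves still pending, and the moves made. -/
noncomputable def runMoves (budget : ℝ) :
    ℕ → Layout α → List (Cell α) → ℕ × Layout α × List (Cell α) × List (Cell α)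
  | done, D, [] => (done, D, [], [])
  | done, D, m :: ms =>
      if (done : ℝ) ≤ budget then
        let r := runMoves budget (done + m.size) (D.relocate m) ms
        (r.1, r.2.1, r.2.2.1, m :: r.2.2.2)
      else (done, D, m :: ms, [])

/-- Re-insert/re-delete the updates in the log, in order, as long as the volume `done` processed so far
does not exceed `budget` and no new flush is triggered. (If a new flush is triggered, the work stops and
the rest of the log, if any, becomes part of the log of the new flush.)
Returns the layout, the flush in progress if any, and the objects moved. -/
noncomputable def runLog (ε budget : ℝ) (logEnd : ℕ) :
    ℕ → Layout α → List (Cell α) → Layout α × Option (Flush α) × List (Cell α)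
  | _, D, [] => (D, none, [])
  | done, D, c :: cs =>
      if (done : ℝ) ≤ budget then
        let r : Layout α × Option (Flush α) × List (Cell α) :=
          if c.live then
            let q := insertObject ε D c.name c.size
            (q.1, q.2.1, [q.2.2])
          else
            let q := deleteObject ε D c.name c.size
            (q.1, q.2, [])
        match r.2.1 with
        | none =>
            let q := runLog ε budget logEnd (done + c.size) r.1 cs
            (q.1, q.2.1, r.2.2 ++ q.2.2)
        | some F =>
            let F' : Flush α :=
              { F with
                log := cs
                logEnd := if cs.isEmpty then F.logEnd else max F.logEnd logEnd }
            (r.1, F'.settle, r.2.2)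
      else (D, some ⟨[], c :: cs, logEnd⟩, [])

/-- Perform just over `budget` steps, by volume, of the flush `F`. -/
noncomputable def work (ε budget : ℝ) (D : Layout α) (F : Flush α) :
    Layout α × Option (Flush α) × List (Cell α) :=
  let r := runMoves budget 0 D F.moves
  if r.2.2.1.isEmpty then
    let q := runLog ε budget F.logEnd r.1 r.2.1 F.log
    (q.1, q.2.1, r.2.2.2 ++ q.2.2)
  else (r.2.1, some { F with moves := r.2.2.1 }, r.2.2.2)

/-! ### The deamortized reallocator -/

/-- State of the reallocator between two requests. -/
structure State (α : Type u) where
  table : α → Option ℕ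
  layout : Layout α
  flush : Option (Flush α)

/-- The empty data structure. -/
def State.init : State α where
  table := fun _ => none
  layout := { region := fun _ => ⟨[], 0, [], 0⟩, tail := [], tailSpace := 0, maxLen := 0 }
  flush := none

/-- Serve one request.  If no flush is in progress the update goes to the buffers, possibly triggering
a flush, whose work is left to the subsequent updates.  If a flush is in progress, the update is put at
the end of the log, and just over `(4 / ε) w` steps of the flush are performed, by volume.
Returns the new state and the list of all cells to which an object was written meanwhile: the initial
placement of an inserted object, and every single move of an object. -/
noncomputable def serve (ε : ℝ) (S : State α) (r : Request α) : State α × List (Cell α) :=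
  match r with
  | .insert x w =>
      let D : Layout α := { S.layout with maxLen := max S.layout.maxLen w }
      match S.flush with
      | none =>
          let q := insertObject ε D x w
          (⟨r.apply S.table, q.1, q.2.1.bind Flush.settle⟩, [q.2.2])
      | some F =>
          let c : Cell α := ⟨x, w, F.logEnd, true⟩
          let q := work ε (4 / ε * w) D { F with log := F.log ++ [c], logEnd := F.logEnd + w }
          (⟨r.apply S.table, q.1, q.2.1⟩, c :: q.2.2)
  | .delete x =>
      let w := (S.table x).getD 0
      match S.flush with
      | none =>
          let q := deleteObject ε S.layout x w
          (⟨r.apply S.table, q.1, q.2.bind Flush.settle⟩, [])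
      | some F =>
          let c : Cell α := ⟨x, w, F.logEnd, false⟩
          let q := work ε (4 / ε * w) S.layout { F with log := F.log ++ [c], logEnd := F.logEnd + w }
          (⟨r.apply S.table, q.1, q.2.1⟩, q.2.2)

/-- The state after a sequence of requests. -/
noncomputable def stateAfter (ε : ℝ) (σ : List (Request α)) : State α :=
  σ.foldl (fun S r => (serve ε S r).1) State.init

/-- The cost of serving request `r` after the requests `σ`: `f w` for each time a size-`w` object is
written to an address (its initial allocation and all its moves, counted with multiplicity). -/
noncomputable def requestCost (ε : ℝ) (f : ℕ → ℝ) (σ : List (Request α)) (r : Request α) : ℝ :=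
  ((serve ε (stateAfter ε σ) r).2.map (fun c => f c.size)).sum

end StorageReallocation

namespace StorageReallocation

universe u

variable {α : Type u}

/-! ### Cost functions -/

section CostFunction

variable {f : ℕ → ℝ} (hf : IsCostFunction f)
include hf

/-! Only the sizes of the cells matter for the cost, so addresses and names play almost no role. The
amortized bound comes from the potential K · (cost of everything in the buffers, holes and delete
records included) + (cost of the pending moves) + (2K + 1) · (cost of the log), where K =
`chargeRate ε` is of order (1/ε) lg(1/ε).

The heart is that K times the released buffer contents, together with K times the trigger, pays for
all moves of a flush (`startFlush_cost_le`). Every flushed object is moved twice. Buffered objects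
pay for themselves, so the payload segments remain. By maximality of the boundary b, for each class
k ≥ b some flushed cell c, or the trigger, has class at most k and did not fit into buffer k
(`Layout.Good.exists_skip`). Hence ε · (payload volume) is less than the volume of buffer k plus the
size of c (`cost_payload_le`). If buffer k supplies at least half of ε · (payload volume), its
contents pay at rate 6/ε, because subadditivity makes the cost per unit of length essentially
decreasing and buffer k holds only classes at most k. Otherwise c pays at rate 6/ε. Then c is longer
than ε/2 times a payload that contains an object of class k, so k exceeds the class of c by only
O(lg(1/ε)). Each c is therefore charged for O(lg(1/ε)) classes, which is the source of the
logarithm.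

The invariant `Layout.Good` records that stored cells did not fit into earlier eligible buffers.
This persists because buffers only fill up between flushes. The amortized bound then telescopes
(`sum_le_sum_of_potential`).

For the worst case, every step of a flush except the last is charged its length times f(1), within
the budget (4/ε)w. The last step and the initial write cost at most f(Δ) each (`add_allowance_le`).
-/

theorem IsCostFunction.nonneg {x : ℕ} (hx : 0 < x) : 0 ≤ f x := by
  -- Nonnegativity is not assumed: f 1 ≤ f 2 ≤ 2 f 1 forces 0 ≤ f 1.
  have h1 := hf.subadd 1 1 one_pos one_pos
  have h2 := hf.mono 1 2 one_pos one_le_two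
  have h3 := hf.mono 1 x one_pos hx
  norm_num at h1
  linarith

theorem IsCostFunction.map_mul_le {n v : ℕ} (hn : 0 < n) (hv : 0 < v) : f (n * v) ≤ n * f v := by
  induction n, hn using Nat.le_induction with
  | base => simp
  | succ n hn ih =>
    have h := hf.subadd (n * v) v (Nat.mul_pos hn hv) hv
    rw [Nat.succ_mul]
    push_cast
    linarith

theorem IsCostFunction.le_mul_one {n : ℕ} (hn : 0 < n) : f n ≤ n * f 1 := by
  simpa using hf.map_mul_le hn one_pos

/-- Up to a factor of `3`, the cost per unit of length is decreasing. -/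
theorem IsCostFunction.mul_le_three_mul {x v : ℕ} (hv : 0 < v) (hx : v < 2 * x) :
    f x * v ≤ 3 * x * f v := by
  -- Round x up to a multiple of v. The rounded length is at most x + v ≤ 3x, since v < 2x.
  have h1 : f x ≤ ((x / v + 1 : ℕ) : ℝ) * f v := by
    refine (hf.mono x ((x / v + 1) * v) (by omega) ?_).trans (hf.map_mul_le (Nat.succ_pos _) hv)
    have := Nat.lt_div_mul_add (a := x) hv
    rw [Nat.add_mul]
    omega
  have h2 : (x / v + 1) * v ≤ 3 * x := by
    have := Nat.div_mul_le_self x v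
    rw [Nat.add_mul]
    omega
  have h3 : ((x / v + 1 : ℕ) : ℝ) * v ≤ 3 * x := by exact_mod_cast h2
  have hfv := hf.nonneg hv
  calc f x * v ≤ ((x / v + 1 : ℕ) : ℝ) * f v * v := by gcongr
    _ = ((x / v + 1 : ℕ) : ℝ) * v * f v := by ring
    _ ≤ 3 * x * f v := by gcongr

end CostFunction

/-! ### Size classes -/

theorem lt_two_pow_of_sizeClass_le {v k : ℕ} (h : sizeClass v ≤ k) : v < 2 ^ k :=
  Nat.size_le.1 h

theorem two_pow_le_two_mul {x : ℕ} (hx : 0 < x) : 2 ^ sizeClass x ≤ 2 * x := by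
  have h : 0 < sizeClass x := Nat.size_pos.2 hx
  obtain ⟨k, hk⟩ : ∃ k, sizeClass x = k + 1 := ⟨sizeClass x - 1, by omega⟩
  have : 2 ^ k ≤ x := Nat.lt_size.1 (by unfold sizeClass at hk; omega)
  rw [hk, pow_succ]
  omega

theorem sizeClass_mono {v w : ℕ} (h : v ≤ w) : sizeClass v ≤ sizeClass w := Nat.size_le_size h

/-! ### Volume and cost of lists of cells -/

/-- The total cost of writing the objects of a list of cells. -/
def cost (f : ℕ → ℝ) (l : List (Cell α)) : ℝ := (l.map fun c => f c.size).sum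

@[simp] theorem vol_nil : vol ([] : List (Cell α)) = 0 := rfl

@[simp] theorem vol_cons (c : Cell α) (l : List (Cell α)) : vol (c :: l) = c.size + vol l := by
  simp [vol]

@[simp] theorem vol_append (l l' : List (Cell α)) : vol (l ++ l') = vol l + vol l' := by
  simp [vol]

@[simp] theorem cost_nil (f : ℕ → ℝ) : cost f ([] : List (Cell α)) = 0 := rfl

@[simp] theorem cost_cons (f : ℕ → ℝ) (c : Cell α) (l : List (Cell α)) :
    cost f (c :: l) = f c.size + cost f l := by
  simp [cost]

@[simp] theorem cost_append (f : ℕ → ℝ) (l l' : List (Cell α)) :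
    cost f (l ++ l') = cost f l + cost f l' := by
  simp [cost]

@[simp] theorem cost_reverse (f : ℕ → ℝ) (l : List (Cell α)) : cost f l.reverse = cost f l := by
  simp [cost]

theorem cost_flatMap (f : ℕ → ℝ) (ks : List ℕ) (g : ℕ → List (Cell α)) :
    cost f (ks.flatMap g) = (ks.map fun k => cost f (g k)).sum := by
  induction ks with
  | nil => rfl
  | cons k ks ih => simp [ih]

@[simp] theorem map_size_layOut (s : ℕ) (l : List (Cell α)) :
    (layOut s l).map Cell.size = l.map Cell.size := by
  induction l generalizing s with
  | nil => rfl
  | cons c l ih => simp [layOut, ih]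

theorem cost_eq_of_map_size {l l' : List (Cell α)} (f : ℕ → ℝ)
    (h : l.map Cell.size = l'.map Cell.size) : cost f l = cost f l' := by
  have e (l : List (Cell α)) : cost f l = ((l.map Cell.size).map f).sum := by simp [cost]; rfl
  rw [e, e, h]

theorem vol_eq_of_map_size {l l' : List (Cell α)} (h : l.map Cell.size = l'.map Cell.size) :
    vol l = vol l' := by rw [vol, vol, h]

@[simp] theorem cost_layOut (f : ℕ → ℝ) (s : ℕ) (l : List (Cell α)) :
    cost f (layOut s l) = cost f l := cost_eq_of_map_size f (map_size_layOut s l)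

theorem exists_mem_size_eq {l l' : List (Cell α)} (h : l.map Cell.size = l'.map Cell.size)
    {c : Cell α} (hc : c ∈ l) : ∃ c' ∈ l', c'.size = c.size := by
  have : c.size ∈ l'.map Cell.size := h ▸ List.mem_map_of_mem hc
  simpa using this

/-- All sizes are positive and at most `Δ`. -/
def Sized (Δ : ℕ) (l : List (Cell α)) : Prop := ∀ c ∈ l, 0 < c.size ∧ c.size ≤ Δ

theorem Sized.of_map_size {Δ : ℕ} {l l' : List (Cell α)} (h : Sized Δ l')
    (e : l.map Cell.size = l'.map Cell.size) : Sized Δ l := by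
  intro c hc
  obtain ⟨c', h', e'⟩ := exists_mem_size_eq e hc
  exact e' ▸ h c' h'

theorem Sized.subset {Δ : ℕ} {l l' : List (Cell α)} (h : Sized Δ l') (s : l ⊆ l') : Sized Δ l :=
  fun c hc => h c (s hc)

theorem Sized.mono {Δ Δ' : ℕ} {l : List (Cell α)} (h : Sized Δ l) (hΔ : Δ ≤ Δ') : Sized Δ' l :=
  fun c hc => ⟨(h c hc).1, (h c hc).2.trans hΔ⟩

theorem Sized.append {Δ : ℕ} {l l' : List (Cell α)} (h : Sized Δ l) (h' : Sized Δ l') :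
    Sized Δ (l ++ l') := by
  intro c hc
  rcases List.mem_append.1 hc with hc | hc
  exacts [h c hc, h' c hc]

theorem Sized.singleton {Δ : ℕ} {c : Cell α} (h : 0 < c.size) (h' : c.size ≤ Δ) :
    Sized Δ [c] := by
  intro d hd
  rw [List.mem_singleton.1 hd]
  exact ⟨h, h'⟩

theorem Sized.flatMap {Δ : ℕ} {ks : List ℕ} {g : ℕ → List (Cell α)} (h : ∀ k, Sized Δ (g k)) :
    Sized Δ (ks.flatMap g) := by
  intro c hc
  obtain ⟨k, -, hk⟩ := List.mem_flatMap.1 hc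
  exact h k c hk

theorem Sized.layOut {Δ : ℕ} {l : List (Cell α)} (h : Sized Δ l) (s : ℕ) :
    Sized Δ (layOut s l) := h.of_map_size (map_size_layOut s l)

theorem Sized.cost_nonneg {Δ : ℕ} {l : List (Cell α)} {f : ℕ → ℝ} (hf : IsCostFunction f)
    (h : Sized Δ l) : 0 ≤ cost f l := by
  refine List.sum_nonneg fun x hx => ?_
  obtain ⟨c, hc, rfl⟩ := List.mem_map.1 hx
  exact hf.nonneg (h c hc).1

theorem Sized.cost_sublist {Δ : ℕ} {l l' : List (Cell α)} {f : ℕ → ℝ} (hf : IsCostFunction f)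
    (h : Sized Δ l') (s : l.Sublist l') : cost f l ≤ cost f l' := by
  induction s with
  | slnil => simp
  | cons a s ih =>
    have := ih (h.subset (by simp))
    have := hf.nonneg (h a (by simp)).1
    rw [cost_cons]
    linarith
  | cons_cons a s ih =>
    have := ih (h.subset (by simp))
    simpa using this

theorem vol_sublist {l l' : List (Cell α)} (s : l.Sublist l') : vol l ≤ vol l' :=
  (s.map _).sum_le_sum (by simp)

theorem Sized.eq_nil_of_vol {Δ : ℕ} {l : List (Cell α)} (h : Sized Δ l) (hv : vol l = 0) :
    l = [] := by
  cases l with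
  | nil => rfl
  | cons c l =>
    have := (h c (by simp)).1
    simp at hv
    omega

/-! ### Charging a payload segment -/

/-- A length v of class at most k is less than twice any length of class k, so
`IsCostFunction.mul_le_three_mul` applies to each cell of `p` separately. -/
theorem cost_mul_le {f : ℕ → ℝ} (hf : IsCostFunction f) {k v : ℕ} {p : List (Cell α)}
    (hp : ∀ c ∈ p, 0 < c.size ∧ sizeClass c.size = k) (hv : 0 < v) (hvk : sizeClass v ≤ k) :
    cost f p * v ≤ 3 * vol p * f v := by
  induction p with
  | nil => simp
  | cons c p ih =>
    have h1 := ih fun d hd => hp d (by simp [hd])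
    obtain ⟨hc, hck⟩ := hp c (by simp)
    have h2 : v < 2 * c.size :=
      (lt_two_pow_of_sizeClass_le hvk).trans_le (hck ▸ two_pow_le_two_mul hc)
    have h3 := hf.mul_le_three_mul hv h2
    rw [cost_cons, vol_cons]
    push_cast
    linarith

theorem cost_mul_vol_le {f : ℕ → ℝ} (hf : IsCostFunction f) {k : ℕ} {p q : List (Cell α)}
    (hp : ∀ c ∈ p, 0 < c.size ∧ sizeClass c.size = k)
    (hq : ∀ c ∈ q, 0 < c.size ∧ sizeClass c.size ≤ k) :
    cost f p * vol q ≤ 3 * vol p * cost f q := by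
  induction q with
  | nil => simp
  | cons c q ih =>
    have h1 := ih fun d hd => hq d (by simp [hd])
    have h2 := cost_mul_le hf hp (hq c (by simp)).1 (hq c (by simp)).2
    rw [cost_cons, vol_cons]
    push_cast
    linarith

/-- The cost of moving a payload segment is paid for by the contents of its buffer, or by an update
that skipped the buffer and whose size class is not much smaller. -/
theorem cost_payload_le {f : ℕ → ℝ} (hf : IsCostFunction f) {ε : ℝ} (hε : 0 < ε) {k w m : ℕ}
    {p q : List (Cell α)} (hp : ∀ c ∈ p, 0 < c.size ∧ sizeClass c.size = k)
    (hq : ∀ c ∈ q, 0 < c.size ∧ sizeClass c.size ≤ k) (hw : 0 < w) (hwk : sizeClass w ≤ k)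
    (h : ε * vol p < vol q + w) (hm : 1 / ε ≤ 2 ^ m) :
    cost f p ≤ 6 / ε * cost f q ∨ cost f p ≤ 6 / ε * f w ∧ k ≤ sizeClass w + (m + 1) := by
  have hcp : 0 ≤ cost f p := Sized.cost_nonneg (Δ := vol p) hf fun c hc =>
    ⟨(hp c hc).1, List.le_sum_of_mem (List.mem_map_of_mem hc)⟩
  have hcq : 0 ≤ cost f q := Sized.cost_nonneg (Δ := vol q) hf fun c hc =>
    ⟨(hq c hc).1, List.le_sum_of_mem (List.mem_map_of_mem hc)⟩
  have hfw := hf.nonneg hw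
  rcases p with _ | ⟨c, p'⟩
  · left
    simp only [cost_nil]
    positivity
  generalize hpp : c :: p' = p at *
  have hcv : c.size ≤ vol p := by simp [← hpp]
  obtain ⟨hc0, hck⟩ := hp c (by simp [← hpp])
  have hv0 : (0 : ℝ) < vol p := by exact_mod_cast hc0.trans_le hcv
  -- Either `q` or `w` accounts for at least half of ε · vol p. The constant 6 is this factor 2
  -- times the 3 from the comparison of unit costs.
  rcases le_or_gt (ε * vol p) (2 * vol q) with hA | hB
  · left
    have h1 := cost_mul_vol_le hf hp hq
    have h2 : cost f p * (ε * vol p) ≤ 6 * cost f q * vol p := by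
      nlinarith [mul_le_mul_of_nonneg_left hA hcp]
    have h3 : cost f p * ε ≤ 6 * cost f q := by
      refine le_of_mul_le_mul_right ?_ hv0
      linarith
    rw [div_mul_eq_mul_div, le_div_iff₀ hε]
    exact h3
  · right
    have hB' : ε * vol p < 2 * w := by linarith
    constructor
    · have h1 := cost_mul_le hf hp hw hwk
      have hw' : (0 : ℝ) < w := by exact_mod_cast hw
      have h3 : cost f p * ε ≤ 6 * f w := by
        refine le_of_mul_le_mul_right ?_ hw'
        nlinarith [mul_le_mul_of_nonneg_left hB'.le hfw, mul_le_mul_of_nonneg_left h1 hε.le]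
      rw [div_mul_eq_mul_div, le_div_iff₀ hε]
      exact h3
    -- If k ≥ sizeClass w + m + 2, an object of class k in `p` gives ε · vol p ≥ 2 · 2 ^ sizeClass w
    -- · (ε · 2 ^ m) > 2w, against `hB'`.
    · by_contra! hk
      have h1 : (2 : ℝ) ^ k ≤ 2 * vol p := by
        have := two_pow_le_two_mul hc0
        rw [hck] at this
        exact_mod_cast this.trans (by omega)
      have h2 : (w : ℝ) < 2 ^ sizeClass w := by
        exact_mod_cast lt_two_pow_of_sizeClass_le le_rfl
      have h3 : (2 : ℝ) ^ (sizeClass w + (m + 2)) ≤ 2 ^ k :=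
        pow_le_pow_right₀ one_le_two (by omega)
      have h4 : (2 : ℝ) ^ (sizeClass w + (m + 2)) = 4 * 2 ^ sizeClass w * 2 ^ m := by ring
      have h5 : 1 ≤ ε * 2 ^ m := by
        rw [div_le_iff₀ hε] at hm
        linarith
      have h6 : (0 : ℝ) < 2 ^ sizeClass w := by positivity
      nlinarith [mul_le_mul_of_nonneg_left h5 h6.le, mul_le_mul_of_nonneg_left (h3.trans h1) hε.le]

/-- Each cell pays for at most `m + 1` indices. -/
theorem sum_charge_le {f : ℕ → ℝ} (I : List (Cell α)) (hI : ∀ c ∈ I, 0 ≤ f c.size)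
    (s : Finset ℕ) (m : ℕ) :
    ∑ k ∈ s, (I.map fun c =>
      if sizeClass c.size ≤ k ∧ k ≤ sizeClass c.size + m then f c.size else 0).sum
      ≤ (m + 1) * cost f I := by
  induction I with
  | nil => simp
  | cons c I ih =>
    have h1 := ih fun d hd => hI d (by simp [hd])
    have h2 : ∑ k ∈ s, (if sizeClass c.size ≤ k ∧ k ≤ sizeClass c.size + m then f c.size else 0)
        ≤ (m + 1) * f c.size := by
      rw [← Finset.sum_filter, Finset.sum_const, nsmul_eq_mul]
      refine mul_le_mul_of_nonneg_right ?_ (hI c (by simp))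
      have h3 : (s.filter fun k => sizeClass c.size ≤ k ∧ k ≤ sizeClass c.size + m)
          ⊆ Finset.Icc (sizeClass c.size) (sizeClass c.size + m) := by
        intro k hk
        simpa using (Finset.mem_filter.1 hk).2
      have h4 := Finset.card_le_card h3
      rw [Nat.card_Icc] at h4
      exact_mod_cast h4.trans (by omega)
    simp only [List.map_cons, List.sum_cons, Finset.sum_add_distrib, cost_cons]
    linarith

/-- Abstract form of the charging: an index k is paid for either locally by `A k` or by a cell whose
class lies in the window [k - m, k]. No injectivity is needed, since a cell can be charged at most m
+ 1 times. -/
theorem sum_le_of_charge {f : ℕ → ℝ} (I : List (Cell α)) (hI : ∀ c ∈ I, 0 ≤ f c.size)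
    (s : Finset ℕ) (m : ℕ) {X : ℝ} (hX : 0 ≤ X) (P A : ℕ → ℝ) (hA : ∀ k ∈ s, 0 ≤ A k)
    (h : ∀ k ∈ s, P k ≤ A k ∨
      ∃ c ∈ I, P k ≤ X * f c.size ∧ sizeClass c.size ≤ k ∧ k ≤ sizeClass c.size + m) :
    ∑ k ∈ s, P k ≤ ∑ k ∈ s, A k + X * ((m + 1) * cost f I) := by
  have key : ∀ k ∈ s, P k ≤ A k + X * (I.map fun c =>
      if sizeClass c.size ≤ k ∧ k ≤ sizeClass c.size + m then f c.size else 0).sum := by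
    intro k hk
    have h0 : ∀ x ∈ I.map (fun c =>
        if sizeClass c.size ≤ k ∧ k ≤ sizeClass c.size + m then f c.size else 0), 0 ≤ x := by
      intro x hx
      obtain ⟨c, hc, rfl⟩ := List.mem_map.1 hx
      split_ifs
      exacts [hI c hc, le_rfl]
    rcases h k hk with h1 | ⟨c, hc, h1, h2⟩
    · have := mul_nonneg hX (List.sum_nonneg h0)
      linarith
    · have h3 := List.single_le_sum h0 _ (List.mem_map_of_mem hc)
      rw [if_pos h2] at h3
      have := mul_le_mul_of_nonneg_left h3 hX
      have := hA k hk
      linarith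
  refine (Finset.sum_le_sum key).trans ?_
  rw [Finset.sum_add_distrib, ← Finset.mul_sum]
  have := mul_le_mul_of_nonneg_left (sum_charge_le I hI s m) hX
  linarith

namespace Layout

/-! ### The invariant of the layout -/

/-- The invariant of the layout.  The last three clauses say that a cell is stored in a buffer only if
it did not fit into the earlier ones, and that size classes not seen yet have no space. -/
structure Good (ε : ℝ) (D : Layout α) : Prop where
  bufSpace_eq : ∀ k, (D.region k).bufSpace = ⌊ε * ((D.region k).paySpace : ℝ)⌋₊
  vol_payload : ∀ k, vol (D.region k).payload ≤ (D.region k).paySpace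
  vol_buffer : ∀ k, vol (D.region k).buffer ≤ (D.region k).bufSpace
  class_payload : ∀ k, ∀ c ∈ (D.region k).payload, sizeClass c.size = k
  class_buffer : ∀ k, ∀ c ∈ (D.region k).buffer, sizeClass c.size ≤ k
  sized_payload : ∀ k, Sized D.maxLen (D.region k).payload
  sized_buffer : ∀ k, Sized D.maxLen (D.region k).buffer
  sized_tail : Sized D.maxLen D.tail
  skip_buffer : ∀ j, ∀ c ∈ (D.region j).buffer, ∀ k, sizeClass c.size ≤ k → k < j →
    (D.region k).bufSpace < vol (D.region k).buffer + c.size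
  skip_tail : ∀ c ∈ D.tail, ∀ k, sizeClass c.size ≤ k →
    (D.region k).bufSpace < vol (D.region k).buffer + c.size
  paySpace_above : ∀ k, D.numClasses < k → (D.region k).paySpace = 0

/-- The total cost of the cells in the buffers, counting holes and delete records as objects. -/
def bufferCost (f : ℕ → ℝ) (D : Layout α) : ℝ :=
  ∑ k ∈ Finset.range (D.numClasses + 1), cost f (D.region k).buffer + cost f D.tail

theorem mem_classesFrom {D : Layout α} {b k : ℕ} :
    k ∈ D.classesFrom b ↔ k ≤ D.numClasses ∧ b ≤ k := by
  simp [classesFrom]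

theorem sum_classesFrom (D : Layout α) (b : ℕ) (g : ℕ → ℝ) :
    ((D.classesFrom b).map g).sum
      = ∑ k ∈ (Finset.range (D.numClasses + 1)).filter (fun k => b ≤ k), g k := by
  rw [classesFrom, ← List.sum_toFinset _ (List.nodup_range.filter _)]
  refine Finset.sum_congr ?_ fun _ _ => rfl
  ext k
  simp

namespace Good

variable {ε : ℝ} {D : Layout α}

theorem bufSpace_eq_zero (h : D.Good ε) {k : ℕ} (hk : (D.region k).paySpace = 0) :
    (D.region k).bufSpace = 0 := by
  rw [h.bufSpace_eq, hk]
  simp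

theorem buffer_eq_nil (h : D.Good ε) {k : ℕ} (hk : (D.region k).paySpace = 0) :
    (D.region k).buffer = [] := by
  refine (h.sized_buffer k).eq_nil_of_vol ?_
  have := h.vol_buffer k
  rw [h.bufSpace_eq_zero hk] at this
  omega

theorem bufferCost_nonneg (h : D.Good ε) {f : ℕ → ℝ} (hf : IsCostFunction f) :
    0 ≤ D.bufferCost f :=
  add_nonneg (Finset.sum_nonneg fun k _ => (h.sized_buffer k).cost_nonneg hf)
    (h.sized_tail.cost_nonneg hf)

/-- The invariant depends on the sizes of the cells only. -/
theorem congr (h : D.Good ε) {D' : Layout α} (hm : D'.maxLen = D.maxLen)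
    (hps : ∀ k, (D'.region k).paySpace = (D.region k).paySpace)
    (hbs : ∀ k, (D'.region k).bufSpace = (D.region k).bufSpace)
    (hb : ∀ k, (D'.region k).buffer.map Cell.size = (D.region k).buffer.map Cell.size)
    (ht : D'.tail.map Cell.size = D.tail.map Cell.size)
    (hpv : ∀ k, vol (D'.region k).payload ≤ vol (D.region k).payload)
    (hp : ∀ k, ∀ c ∈ (D'.region k).payload, ∃ c' ∈ (D.region k).payload, c'.size = c.size) :
    D'.Good ε where
  bufSpace_eq k := by rw [hbs, hps, h.bufSpace_eq]
  vol_payload k := by rw [hps]; exact (hpv k).trans (h.vol_payload k)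
  vol_buffer k := by rw [vol_eq_of_map_size (hb k), hbs]; exact h.vol_buffer k
  class_payload k c hc := by
    obtain ⟨c', h', e⟩ := hp k c hc
    exact e ▸ h.class_payload k c' h'
  class_buffer k c hc := by
    obtain ⟨c', h', e⟩ := exists_mem_size_eq (hb k) hc
    exact e ▸ h.class_buffer k c' h'
  sized_payload k c hc := by
    obtain ⟨c', h', e⟩ := hp k c hc
    exact hm ▸ e ▸ h.sized_payload k c' h'
  sized_buffer k := by rw [hm]; exact (h.sized_buffer k).of_map_size (hb k)
  sized_tail := by rw [hm]; exact h.sized_tail.of_map_size ht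
  skip_buffer j c hc k h1 h2 := by
    obtain ⟨c', h', e⟩ := exists_mem_size_eq (hb j) hc
    rw [hbs, vol_eq_of_map_size (hb k), ← e]
    exact h.skip_buffer j c' h' k (e ▸ h1) h2
  skip_tail c hc k h1 := by
    obtain ⟨c', h', e⟩ := exists_mem_size_eq ht hc
    rw [hbs, vol_eq_of_map_size (hb k), ← e]
    exact h.skip_tail c' h' k (e ▸ h1)
  paySpace_above k hk := by
    rw [hps]
    exact h.paySpace_above k (by simpa [numClasses, hm] using hk)

theorem withMaxLen (h : D.Good ε) {m : ℕ} (hm : D.maxLen ≤ m) :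
    Good ε { D with maxLen := m } where
  bufSpace_eq := h.bufSpace_eq
  vol_payload := h.vol_payload
  vol_buffer := h.vol_buffer
  class_payload := h.class_payload
  class_buffer := h.class_buffer
  sized_payload k := (h.sized_payload k).mono hm
  sized_buffer k := (h.sized_buffer k).mono hm
  sized_tail := h.sized_tail.mono hm
  skip_buffer := h.skip_buffer
  skip_tail := h.skip_tail
  paySpace_above k hk := h.paySpace_above k ((sizeClass_mono hm).trans_lt hk)

/-- Raising Δ only adds size classes without space, whose buffers are empty. -/
theorem bufferCost_withMaxLen (h : D.Good ε) {m : ℕ} (hm : D.maxLen ≤ m) (f : ℕ → ℝ) :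
    bufferCost f { D with maxLen := m } = D.bufferCost f := by
  unfold bufferCost
  congr 1
  symm
  refine Finset.sum_subset ?_ ?_
  · exact Finset.range_mono (Nat.succ_le_succ (sizeClass_mono hm))
  · intro k _ hk
    have : D.numClasses < k := by simpa [Nat.lt_succ_iff] using hk
    simp only [h.buffer_eq_nil (h.paySpace_above k this), cost_nil]

end Good

theorem bufferCost_congr {D D' : Layout α} (hm : D'.maxLen = D.maxLen)
    (hb : ∀ k, (D'.region k).buffer.map Cell.size = (D.region k).buffer.map Cell.size)
    (ht : D'.tail.map Cell.size = D.tail.map Cell.size) (f : ℕ → ℝ) :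
    D'.bufferCost f = D.bufferCost f := by
  unfold bufferCost numClasses
  rw [hm, cost_eq_of_map_size f ht]
  congr 1
  exact Finset.sum_congr rfl fun k _ => cost_eq_of_map_size f (hb k)

section Names

variable [DecidableEq α]

theorem map_size_kill (x : α) (l : List (Cell α)) :
    (l.map fun c => if c.name = x then { c with live := false } else c).map Cell.size
      = l.map Cell.size := by
  rw [List.map_map]
  refine List.map_congr_left fun c _ => ?_
  simp only [Function.comp_apply]
  split_ifs <;> rfl

theorem map_size_move (m : Cell α) (l : List (Cell α)) :
    (l.map fun c => if c.name = m.name then { c with addr := m.addr } else c).map Cell.size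
      = l.map Cell.size := by
  rw [List.map_map]
  refine List.map_congr_left fun c _ => ?_
  simp only [Function.comp_apply]
  split_ifs <;> rfl

theorem Good.remove {ε : ℝ} {D : Layout α} (h : D.Good ε) (x : α) : (D.remove x).Good ε :=
  h.congr rfl (fun _ => rfl) (fun _ => rfl) (fun _ => map_size_kill x _) (map_size_kill x _)
    (fun _ => vol_sublist List.filter_sublist)
    fun _ c hc => ⟨c, (List.mem_filter.1 hc).1, rfl⟩

theorem bufferCost_remove (D : Layout α) (x : α) (f : ℕ → ℝ) :
    (D.remove x).bufferCost f = D.bufferCost f :=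
  bufferCost_congr (D := D) (D' := D.remove x) rfl (fun _ => map_size_kill x _)
    (map_size_kill x _) f

theorem Good.relocate {ε : ℝ} {D : Layout α} (h : D.Good ε) (m : Cell α) :
    (D.relocate m).Good ε :=
  h.congr rfl (fun _ => rfl) (fun _ => rfl) (fun _ => rfl) rfl
    (fun _ => (vol_eq_of_map_size (map_size_move m _)).le)
    fun _ _ hc => exists_mem_size_eq (map_size_move m _) hc

theorem bufferCost_relocate (D : Layout α) (m : Cell α) (f : ℕ → ℝ) :
    (D.relocate m).bufferCost f = D.bufferCost f :=
  bufferCost_congr (D := D) (D' := D.relocate m) rfl (fun _ => rfl) rfl f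

end Names

/-! ### Storing a cell in a buffer -/

/-- Appending a cell to the tail buffer preserves the invariant if no other buffer has space for it. -/
theorem Good.append_tail {ε : ℝ} {D : Layout α} (h : D.Good ε) (c : Cell α) (hc : 0 < c.size)
    (hm : c.size ≤ D.maxLen)
    (hs : ∀ k, sizeClass c.size ≤ k → (D.region k).bufSpace < vol (D.region k).buffer + c.size) :
    Good ε { D with tail := D.tail ++ [c] } :=
  { h with
    sized_tail := h.sized_tail.append (.singleton hc hm)
    skip_tail := by
      intro d hd
      rcases List.mem_append.1 hd with hd | hd
      · exact h.skip_tail d hd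
      · rw [List.mem_singleton.1 hd]
        exact hs }

theorem bufferCost_append_tail (D : Layout α) (c : Cell α) (f : ℕ → ℝ) :
    bufferCost f { D with tail := D.tail ++ [c] } = D.bufferCost f + f c.size := by
  have : cost f (D.tail ++ [c]) = cost f D.tail + f c.size := by simp
  simp only [bufferCost, numClasses]
  rw [this]
  ring

/-- Append a cell to buffer `j`. -/
def appendBuffer (D : Layout α) (j : ℕ) (c : Cell α) : Layout α :=
  { D with
    region := Function.update D.region j
      ({ D.region j with buffer := (D.region j).buffer ++ [c] }) }

/-- Old cells keep their skip clauses because the volume of a buffer only grows while its space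
stays fixed. First fit supplies the clause of the new cell. -/
theorem Good.append_buffer {ε : ℝ} {D : Layout α} (h : D.Good ε) (c : Cell α) (hc : 0 < c.size)
    (hm : c.size ≤ D.maxLen) {j : ℕ} (hj : sizeClass c.size ≤ j)
    (hfit : vol (D.region j).buffer + c.size ≤ (D.region j).bufSpace)
    (hs : ∀ k, sizeClass c.size ≤ k → k < j →
      (D.region k).bufSpace < vol (D.region k).buffer + c.size) :
    (D.appendBuffer j c).Good ε := by
  set D' : Layout α := D.appendBuffer j c with hD'
  have hpay (k) : (D'.region k).payload = (D.region k).payload := by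
    by_cases hk : k = j
    · subst hk; simp [hD', appendBuffer]
    · simp [hD', appendBuffer, hk]
  have hps (k) : (D'.region k).paySpace = (D.region k).paySpace := by
    by_cases hk : k = j
    · subst hk; simp [hD', appendBuffer]
    · simp [hD', appendBuffer, hk]
  have hbs (k) : (D'.region k).bufSpace = (D.region k).bufSpace := by
    by_cases hk : k = j
    · subst hk; simp [hD', appendBuffer]
    · simp [hD', appendBuffer, hk]
  have hbj : (D'.region j).buffer = (D.region j).buffer ++ [c] := by simp [hD', appendBuffer]
  have hbk (k) (hk : k ≠ j) : (D'.region k).buffer = (D.region k).buffer := by simp [hD', appendBuffer, hk]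
  have hmem (k) (d) (hd : d ∈ (D'.region k).buffer) :
      d ∈ (D.region k).buffer ∨ k = j ∧ d = c := by
    by_cases hk : k = j
    · subst hk
      rw [hbj] at hd
      simpa using hd
    · exact .inl (hbk k hk ▸ hd)
  have hvol (k) : vol (D.region k).buffer ≤ vol (D'.region k).buffer := by
    by_cases hk : k = j
    · subst hk; simp [hbj]
    · rw [hbk k hk]
  constructor
  · intro k; rw [hbs, hps, h.bufSpace_eq]
  · intro k; rw [hpay, hps]; exact h.vol_payload k
  · intro k
    rw [hbs]
    by_cases hk : k = j
    · subst hk; simpa [hbj] using hfit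
    · rw [hbk k hk]; exact h.vol_buffer k
  · intro k; rw [hpay]; exact h.class_payload k
  · intro k d hd
    rcases hmem k d hd with hd | ⟨rfl, rfl⟩
    exacts [h.class_buffer k d hd, hj]
  · intro k; rw [hpay]; exact h.sized_payload k
  · intro k d hd
    rcases hmem k d hd with hd | ⟨rfl, rfl⟩
    exacts [h.sized_buffer k d hd, ⟨hc, hm⟩]
  · exact h.sized_tail
  · intro i d hd k h1 h2
    rw [hbs]
    refine lt_of_lt_of_le ?_ (Nat.add_le_add_right (hvol k) _)
    rcases hmem i d hd with hd | ⟨rfl, rfl⟩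
    exacts [h.skip_buffer i d hd k h1 h2, hs k h1 h2]
  · intro d hd k h1
    rw [hbs]
    exact lt_of_lt_of_le (h.skip_tail d hd k h1) (Nat.add_le_add_right (hvol k) _)
  · intro k hk; rw [hps]; exact h.paySpace_above k hk

theorem bufferCost_append_buffer (D : Layout α) (c : Cell α) {j : ℕ} (hj : j ≤ D.numClasses)
    (f : ℕ → ℝ) :
    (D.appendBuffer j c).bufferCost f = D.bufferCost f + f c.size := by
  have hmem : j ∈ Finset.range (D.numClasses + 1) := by simpa [Nat.lt_succ_iff] using hj
  have e : ∀ k, cost f ((D.appendBuffer j c).region k).buffer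
      = cost f (D.region k).buffer + if k = j then f c.size else 0 := by
    intro k
    by_cases hk : k = j
    · subst hk; simp [appendBuffer]
    · simp [appendBuffer, hk]
  have hn : (D.appendBuffer j c).numClasses = D.numClasses := rfl
  have ht : (D.appendBuffer j c).tail = D.tail := rfl
  simp only [bufferCost, hn, ht, e, Finset.sum_add_distrib, Finset.sum_ite_eq', hmem, if_true]
  ring

theorem Good.store_some {ε : ℝ} {D D' : Layout α} (h : D.Good ε) {x : α} {w : ℕ} {live : Bool}
    {c : Cell α} (hw : 0 < w) (hm : w ≤ D.maxLen) (hst : D.store x w live = some (D', c)) :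
    D'.Good ε ∧ D'.maxLen = D.maxLen ∧ c.size = w ∧
      ∀ f, D'.bufferCost f = D.bufferCost f + f w := by
  unfold store at hst
  split at hst
  · rename_i j hj
    -- The search returns the least index that fits, so `h3` says that every earlier index fails.
    -- This is the skip clause for the new cell.
    rw [classesFrom, List.find?_filter, List.find?_range_eq_some] at hj
    obtain ⟨h1, h2, h3⟩ := hj
    simp only [Option.some.injEq, Prod.mk.injEq] at hst
    obtain ⟨rfl, rfl⟩ := hst
    simp only [decide_eq_true_eq] at h1
    have hjn : j ≤ D.numClasses := by simpa [Nat.lt_succ_iff] using h2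
    refine ⟨h.append_buffer ⟨x, w, _, live⟩ hw hm h1.1 h1.2 fun k hk hkj => ?_, rfl, rfl, fun f =>
      bufferCost_append_buffer D _ hjn f⟩
    have := h3 k hkj
    simp only [decide_eq_true_eq, Bool.not_eq_true', decide_eq_false_iff_not, not_and,
      not_le] at this
    exact this hk
  · rename_i hj
    have hs : ∀ k, sizeClass w ≤ k → (D.region k).bufSpace < vol (D.region k).buffer + w := by
      intro k hk
      by_cases hkn : k ≤ D.numClasses
      · have := List.find?_eq_none.1 hj k (mem_classesFrom.2 ⟨hkn, hk⟩)
        simpa using this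
      · rw [h.bufSpace_eq_zero (h.paySpace_above k (by omega))]
        omega
    split_ifs at hst
    simp only [Option.some.injEq, Prod.mk.injEq] at hst
    obtain ⟨rfl, rfl⟩ := hst
    exact ⟨h.append_tail _ hw hm hs, rfl, rfl, fun f => bufferCost_append_tail D _ f⟩

/-- The search covers only the existing classes, but larger ones have no buffer space, so a positive
size does not fit there either. -/
theorem Good.store_none {ε : ℝ} {D : Layout α} (h : D.Good ε) {x : α} {w : ℕ} {live : Bool}
    (hw : 0 < w) (hst : D.store x w live = none) (k : ℕ) (hk : sizeClass w ≤ k) :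
    (D.region k).bufSpace < vol (D.region k).buffer + w := by
  unfold store at hst
  split at hst
  · simp at hst
  · rename_i hj
    by_cases hkn : k ≤ D.numClasses
    · have := List.find?_eq_none.1 hj k (mem_classesFrom.2 ⟨hkn, hk⟩)
      simpa using this
    · rw [h.bufSpace_eq_zero (h.paySpace_above k (by omega))]
      omega

/-! ### The boundary and the target of a flush -/

theorem Good.sized_buffered {ε : ℝ} {D : Layout α} (h : D.Good ε) (b : ℕ) :
    Sized D.maxLen (D.buffered b) :=
  (Sized.flatMap fun k => (h.sized_buffer k).subset (List.filter_subset_self _)).append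
    (h.sized_tail.subset (List.filter_subset_self _))

/-- Flushed buffers and the tail become empty, so they impose no skip clause. The clauses of a
buffer j < b mention only buffers before j, which are untouched. -/
theorem Good.target {ε : ℝ} {D : Layout α} (h : D.Good ε) (b : ℕ) : (D.target ε b).Good ε := by
  have hlt (k) (hk : k < b) : (D.target ε b).region k = D.region k := if_neg (not_le.2 hk)
  have hge (k) (hk : b ≤ k) : (D.target ε b).region k =
      { payload := (D.region k).payload ++ ofClass k (D.buffered b)
        paySpace := vol ((D.region k).payload ++ ofClass k (D.buffered b))
        buffer := []
        bufSpace := ⌊ε * (vol ((D.region k).payload ++ ofClass k (D.buffered b)) : ℝ)⌋₊ } :=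
    if_pos hk
  have hsz := h.sized_buffered b
  constructor
  · intro k
    rcases lt_or_ge k b with hk | hk
    · rw [hlt k hk, h.bufSpace_eq]
    · rw [hge k hk]
  · intro k
    rcases lt_or_ge k b with hk | hk
    · rw [hlt k hk]; exact h.vol_payload k
    · rw [hge k hk]
  · intro k
    rcases lt_or_ge k b with hk | hk
    · rw [hlt k hk]; exact h.vol_buffer k
    · rw [hge k hk]; exact Nat.zero_le _
  · intro k
    rcases lt_or_ge k b with hk | hk
    · rw [hlt k hk]; exact h.class_payload k
    · rw [hge k hk]
      intro c hc
      rcases List.mem_append.1 hc with hc | hc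
      · exact h.class_payload k c hc
      · simpa using (List.mem_filter.1 hc).2
  · intro k
    rcases lt_or_ge k b with hk | hk
    · rw [hlt k hk]; exact h.class_buffer k
    · rw [hge k hk]; simp
  · intro k
    rcases lt_or_ge k b with hk | hk
    · rw [hlt k hk]; exact h.sized_payload k
    · rw [hge k hk]
      exact (h.sized_payload k).append (hsz.subset (List.filter_subset_self _))
  · intro k
    rcases lt_or_ge k b with hk | hk
    · rw [hlt k hk]; exact h.sized_buffer k
    · rw [hge k hk]; intro c hc; simp at hc
  · intro c hc
    exact absurd hc (by simp [Layout.target])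
  · intro j c hc k h1 h2
    rcases lt_or_ge j b with hj | hj
    · rw [hlt j hj] at hc
      rw [hlt k (h2.trans hj)]
      exact h.skip_buffer j c hc k h1 h2
    · rw [hge j hj] at hc; simp at hc
  · intro c hc
    exact absurd hc (by simp [Layout.target])
  · intro k hkn
    replace hkn : D.numClasses < k := hkn
    have h0 := h.paySpace_above k hkn
    rcases lt_or_ge k b with hk | hk
    · rw [hlt k hk]; exact h0
    · rw [hge k hk]
      -- Buffered sizes are at most Δ, so no object lands in a class beyond that of Δ.
      have h1 : ofClass k (D.buffered b) = [] := by
        refine List.filter_eq_nil_iff.2 fun c hc => ?_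
        have := sizeClass_mono (hsz c hc).2
        unfold numClasses at hkn
        simp
        omega
      have := h.vol_payload k
      simp only [vol_append, h1, vol_nil]
      omega

/-- The cost of everything in the buffers `i ≥ b` and the tail buffer is released by a flush. -/
theorem bufferCost_target (ε : ℝ) (D : Layout α) (b : ℕ) (f : ℕ → ℝ) :
    D.bufferCost f = (D.target ε b).bufferCost f
      + cost f ((D.classesFrom b).flatMap (fun k => (D.region k).buffer) ++ D.tail) := by
  have hn : (D.target ε b).numClasses = D.numClasses := rfl
  have ht : (D.target ε b).tail = [] := rfl
  have e : ∀ k, cost f ((D.target ε b).region k).buffer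
      = if b ≤ k then 0 else cost f (D.region k).buffer := by
    intro k
    simp only [target]
    split_ifs <;> simp
  rw [cost_append, cost_flatMap, sum_classesFrom, bufferCost, bufferCost, hn, ht, Finset.sum_filter]
  simp only [e, cost_nil]
  rw [← add_assoc, add_zero, ← Finset.sum_add_distrib]
  congr 1
  refine Finset.sum_congr rfl fun k _ => ?_
  split_ifs <;> simp

/-- For each size class from the boundary on, some cell in a flushed buffer, or the triggering update,
did not fit into the buffer of that size class. -/
theorem Good.exists_skip {ε : ℝ} {D : Layout α} (h : D.Good ε) {c₀ : Cell α}
    (hs : ∀ k, sizeClass c₀.size ≤ k →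
      (D.region k).bufSpace < vol (D.region k).buffer + c₀.size)
    {k : ℕ} (hk : D.boundary (sizeClass c₀.size) ≤ k) :
    ∃ c ∈ ((D.classesFrom (D.boundary (sizeClass c₀.size))).flatMap
        (fun k => (D.region k).buffer) ++ D.tail) ++ [c₀],
      sizeClass c.size ≤ k ∧ (D.region k).bufSpace < vol (D.region k).buffer + c.size := by
  set b := D.boundary (sizeClass c₀.size) with hb
  by_cases hks : sizeClass c₀.size ≤ k
  · exact ⟨c₀, by simp, hks, hs k hks⟩
  -- Now k + 1 is a candidate above the maximal boundary, so it fails: a cell of class at most k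
  -- sits in the tail or in a buffer j > k, and it must have skipped buffer k.
  have hnot := Nat.findGreatest_is_greatest (k := k + 1) (n := sizeClass c₀.size)
    (P := fun b => (∀ c ∈ D.tail, b ≤ sizeClass c.size) ∧
      ∀ j ∈ D.classesFrom b, ∀ c ∈ (D.region j).buffer, b ≤ sizeClass c.size)
    (by change b < k + 1; omega) (by omega)
  by_cases ht : ∀ c ∈ D.tail, k + 1 ≤ sizeClass c.size
  · have : ∃ j ∈ D.classesFrom (k + 1), ∃ c ∈ (D.region j).buffer, sizeClass c.size < k + 1 := by
      by_contra! hcon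
      exact hnot ⟨ht, hcon⟩
    obtain ⟨j, hj, c, hc, hck⟩ := this
    obtain ⟨hjn, hkj⟩ := mem_classesFrom.1 hj
    refine ⟨c, ?_, by omega, h.skip_buffer j c hc k (by omega) (by omega)⟩
    simp only [List.mem_append, List.mem_flatMap]
    exact .inl (.inl ⟨j, mem_classesFrom.2 ⟨hjn, by omega⟩, hc⟩)
  · push Not at ht
    obtain ⟨c, hc, hck⟩ := ht
    exact ⟨c, by simp [hc], by omega, h.skip_tail c hc k (by omega)⟩

end Layout

/-! ### The cost of a flush -/

theorem sum_cost_ofClass_le {f : ℕ → ℝ} (l : List (Cell α)) (hl : ∀ c ∈ l, 0 ≤ f c.size)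
    (s : Finset ℕ) : ∑ k ∈ s, cost f (ofClass k l) ≤ cost f l := by
  induction l with
  | nil => simp [ofClass]
  | cons c l ih =>
    have h1 := ih fun d hd => hl d (by simp [hd])
    have e : ∀ k, cost f (ofClass k (c :: l))
        = (if sizeClass c.size = k then f c.size else 0) + cost f (ofClass k l) := by
      intro k
      by_cases hk : sizeClass c.size = k <;> simp [ofClass, hk]
    simp only [e, Finset.sum_add_distrib, Finset.sum_ite_eq, cost_cons]
    have := hl c (by simp)
    split_ifs <;> linarith

/-- The coefficient of the potential of the buffered cells. -/
noncomputable def chargeRate (ε : ℝ) : ℝ := 61 * (1 / ε * Real.logb 2 (1 / ε))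

theorem one_le_logb {ε : ℝ} (hε : 0 < ε) (hε' : ε ≤ 1 / 2) : 1 ≤ Real.logb 2 (1 / ε) := by
  rw [Real.le_logb_iff_rpow_le one_lt_two (by positivity), Real.rpow_one, le_div_iff₀ hε]
  linarith

theorem two_le_one_div {ε : ℝ} (hε : 0 < ε) (hε' : ε ≤ 1 / 2) : 2 ≤ 1 / ε := by
  rw [le_div_iff₀ hε]
  linarith

theorem one_le_chargeRate {ε : ℝ} (hε : 0 < ε) (hε' : ε ≤ 1 / 2) : 1 ≤ chargeRate ε := by
  have h1 := one_le_logb hε hε'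
  have h2 := two_le_one_div hε hε'
  unfold chargeRate
  nlinarith

/-- Take m = ⌈y⌉ with y = lg(1/ε) ≥ 1. The left side is 2 + (12/ε)(m + 3), and m + 3 ≤ y + 4 ≤ 5y
yields 60 y/ε + 2, which 61 y/ε absorbs. -/
theorem exists_chargeRange {ε : ℝ} (hε : 0 < ε) (hε' : ε ≤ 1 / 2) :
    ∃ m : ℕ, 1 / ε ≤ 2 ^ m ∧ 2 + 2 * (6 / ε + 6 / ε * (m + 1 + 1)) ≤ chargeRate ε := by
  have h1 := one_le_logb hε hε'
  have h2 := two_le_one_div hε hε'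
  refine ⟨⌈Real.logb 2 (1 / ε)⌉₊, ?_, ?_⟩
  · have := Nat.le_ceil (Real.logb 2 (1 / ε))
    rwa [Real.logb_le_iff_le_rpow one_lt_two (by positivity), Real.rpow_natCast] at this
  · have := Nat.ceil_lt_add_one (zero_le_one.trans h1)
    have h6 : 6 / ε = 6 * (1 / ε) := by ring
    unfold chargeRate
    rw [h6]
    generalize Real.logb 2 (1 / ε) = y at *
    generalize 1 / ε = e at *
    have : (⌈y⌉₊ : ℝ) + 3 ≤ 5 * y := by linarith
    nlinarith

/-- The amortized step: the potential released from the flushed buffers, plus K f(w) for the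
trigger, covers all moves of the flush. The argument `v` affects only addresses. -/
theorem startFlush_cost_le {f : ℕ → ℝ} (hf : IsCostFunction f) {ε : ℝ} (hε : 0 < ε)
    (hε' : ε ≤ 1 / 2) {D : Layout α} (h : D.Good ε) {x : α} {w : ℕ} (v : ℕ) (hw : 0 < w)
    (hs : ∀ k, sizeClass w ≤ k → (D.region k).bufSpace < vol (D.region k).buffer + w) :
    chargeRate ε * (startFlush ε D (sizeClass w) v).1.bufferCost f
        + cost f (startFlush ε D (sizeClass w) v).2.moves
      ≤ chargeRate ε * (D.bufferCost f + f w) := by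
  obtain ⟨m, hm, hK⟩ := exists_chargeRange hε hε'
  -- The trigger as a cell, of which only the size matters. It is listed separately because a delete
  -- record that fits nowhere is not stored.
  set c₀ : Cell α := ⟨x, w, 0, true⟩
  set b := D.boundary (sizeClass w) with hb
  set T := (D.classesFrom b).flatMap (fun k => (D.region k).buffer) ++ D.tail with hT
  set s := (Finset.range (D.numClasses + 1)).filter (fun k => b ≤ k) with hs'
  have hTs : Sized D.maxLen T := (Sized.flatMap h.sized_buffer).append h.sized_tail
  have hfw : 0 ≤ f w := hf.nonneg hw
  have hT0 : 0 ≤ cost f T := hTs.cost_nonneg hf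
  have hbs : Sized D.maxLen (D.buffered b) := h.sized_buffered b
  have hbuf : cost f (D.buffered b) ≤ cost f T := by
    rw [Layout.buffered, hT, cost_append, cost_append, cost_flatMap, cost_flatMap]
    refine add_le_add (List.sum_le_sum fun k _ => ?_) ?_
    · exact (h.sized_buffer k).cost_sublist hf List.filter_sublist
    · exact h.sized_tail.cost_sublist hf List.filter_sublist
  have hcls : ∑ k ∈ s, cost f (ofClass k (D.buffered b)) ≤ cost f (D.buffered b) :=
    sum_cost_ofClass_le _ (fun c hc => hf.nonneg (hbs c hc).1) s
  have hbufk : ∑ k ∈ s, 6 / ε * cost f (D.region k).buffer ≤ 6 / ε * cost f T := by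
    rw [← Finset.mul_sum, hT, cost_append, cost_flatMap, Layout.sum_classesFrom]
    refine mul_le_mul_of_nonneg_left ?_ (by positivity)
    have := h.sized_tail.cost_nonneg hf
    linarith
  have hpay : ∑ k ∈ s, cost f (D.region k).payload
      ≤ ∑ k ∈ s, 6 / ε * cost f (D.region k).buffer
        + 6 / ε * (((m + 1 : ℕ) + 1) * cost f (T ++ [c₀])) := by
    refine sum_le_of_charge (T ++ [c₀]) ?_ s (m + 1) (by positivity) _ _ ?_ ?_
    · intro c hc
      rcases List.mem_append.1 hc with hc | hc
      · exact hf.nonneg (hTs c hc).1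
      · rw [List.mem_singleton.1 hc]
        exact hfw
    · intro k _
      have := (h.sized_buffer k).cost_nonneg hf
      positivity
    · intro k hk
      obtain ⟨c, hc, hck, hskip⟩ := h.exists_skip (c₀ := c₀) hs (k := k) (Finset.mem_filter.1 hk).2
      have hc0 : 0 < c.size := by
        rcases List.mem_append.1 hc with hc | hc
        · exact (hTs c hc).1
        · rw [List.mem_singleton.1 hc]
          exact hw
      -- The buffer was sized by the payload space, which still bounds the payload volume after
      -- deletions. A strict inequality between integers lets the floor be dropped.
      have hvol : ε * vol (D.region k).payload < vol (D.region k).buffer + c.size := by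
        rw [h.bufSpace_eq, Nat.floor_lt (by positivity)] at hskip
        push_cast at hskip
        refine lt_of_le_of_lt (mul_le_mul_of_nonneg_left ?_ hε.le) hskip
        exact_mod_cast h.vol_payload k
      rcases cost_payload_le hf hε
          (fun d hd => ⟨(h.sized_payload k d hd).1, h.class_payload k d hd⟩)
          (fun d hd => ⟨(h.sized_buffer k d hd).1, h.class_buffer k d hd⟩) hc0 hck hvol hm with
        h1 | h1
      · exact .inl h1
      · exact .inr ⟨c, hc, h1.1, hck, h1.2⟩
  have hmoves : cost f (startFlush ε D (sizeClass w) v).2.moves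
      = cost f (D.buffered b) + ∑ k ∈ s, cost f (D.region k).payload
        + ∑ k ∈ s, cost f (D.region k).payload + ∑ k ∈ s, cost f (ofClass k (D.buffered b)) := by
    simp only [startFlush, cost_append, cost_layOut, cost_reverse, cost_flatMap,
      Layout.sum_classesFrom]
    rfl
  have hrel := Layout.bufferCost_target ε D b f
  have hD' : (startFlush ε D (sizeClass w) v).1 = D.target ε b := rfl
  have hcT : cost f (T ++ [c₀]) = cost f T + f w := by simp [c₀]
  rw [hmoves, hD', hrel]
  rw [hcT] at hpay
  push_cast at hpay
  have hKm := mul_le_mul_of_nonneg_right hK (add_nonneg hT0 hfw)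
  have h6 : 0 ≤ 6 / ε * f w := by positivity
  linarith

theorem startFlush_sized {ε : ℝ} {D : Layout α} (h : D.Good ε) (s v : ℕ) :
    Sized D.maxLen (startFlush ε D s v).2.moves := by
  have hb := h.sized_buffered (D.boundary s)
  refine (((hb.layOut _).append ?_).append ?_).append ?_
  · exact ((Sized.flatMap h.sized_payload).layOut _).subset fun _ => List.mem_reverse.1
  · exact Sized.flatMap fun k => (h.sized_payload k).layOut _
  · exact Sized.flatMap fun k => (hb.subset (List.filter_subset_self _)).layOut _

/-! ### Updates when no flush is in progress -/

/-- The new buffer is empty, so a cell stored beyond it would violate the skip clauses. There is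
none: the tail is empty and all classes from this one on have no space. -/
theorem Layout.Good.newRegion {ε : ℝ} {D : Layout α} (h : D.Good ε) {c : Cell α} (hc : 0 < c.size)
    (hm : c.size ≤ D.maxLen) (ht : D.tail = [])
    (h0 : ∀ j ∈ D.classesFrom (sizeClass c.size), (D.region j).paySpace = 0) :
    Layout.Good ε { D with
      region := Function.update D.region (sizeClass c.size)
        ⟨[c], c.size, [], ⌊ε * (c.size : ℝ)⌋₊⟩ } := by
  set i := sizeClass c.size with hi
  set R : Region α := ⟨[c], c.size, [], ⌊ε * (c.size : ℝ)⌋₊⟩ with hR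
  have hnil : ∀ j, i ≤ j → (D.region j).buffer = [] := by
    intro j hj
    refine h.buffer_eq_nil ?_
    by_cases hjn : j ≤ D.numClasses
    · exact h0 j (Layout.mem_classesFrom.2 ⟨hjn, hj⟩)
    · exact h.paySpace_above j (by omega)
  set D' : Layout α := { D with region := Function.update D.region i R } with hD'
  have hri : D'.region i = R := by simp [hD']
  have hrk (k) (hk : k ≠ i) : D'.region k = D.region k := by simp [hD', hk]
  have hin : i ≤ D.numClasses := sizeClass_mono hm
  constructor
  · intro k
    by_cases hk : k = i
    · rw [hk, hri]
    · rw [hrk k hk]; exact h.bufSpace_eq k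
  · intro k
    by_cases hk : k = i
    · rw [hk, hri]; simp [hR]
    · rw [hrk k hk]; exact h.vol_payload k
  · intro k
    by_cases hk : k = i
    · rw [hk, hri]; simp [hR]
    · rw [hrk k hk]; exact h.vol_buffer k
  · intro k
    by_cases hk : k = i
    · rw [hk, hri]; simp [hR, hi]
    · rw [hrk k hk]; exact h.class_payload k
  · intro k
    by_cases hk : k = i
    · rw [hk, hri]; simp [hR]
    · rw [hrk k hk]; exact h.class_buffer k
  · intro k
    by_cases hk : k = i
    · rw [hk, hri]; exact .singleton hc hm
    · rw [hrk k hk]; exact h.sized_payload k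
  · intro k
    by_cases hk : k = i
    · rw [hk, hri]; intro d hd; simp [hR] at hd
    · rw [hrk k hk]; exact h.sized_buffer k
  · exact h.sized_tail
  · intro j d hd k h1 h2
    have hji : j < i := by
      by_contra! hji
      by_cases hj : j = i
      · rw [hj, hri] at hd; simp [hR] at hd
      · rw [hrk j hj, hnil j hji] at hd; simp at hd
    rw [hrk j hji.ne] at hd
    rw [hrk k (by omega)]
    exact h.skip_buffer j d hd k h1 h2
  · intro d hd
    have : D'.tail = [] := ht
    rw [this] at hd
    simp at hd
  · intro k hk
    replace hk : D.numClasses < k := hk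
    rw [hrk k (by omega)]
    exact h.paySpace_above k hk

theorem Layout.Good.bufferCost_newRegion_le {ε : ℝ} {D : Layout α} (h : D.Good ε) {f : ℕ → ℝ}
    (hf : IsCostFunction f) (i : ℕ) {R : Region α} (hR : R.buffer = []) :
    Layout.bufferCost f { D with region := Function.update D.region i R } ≤ D.bufferCost f := by
  refine add_le_add (Finset.sum_le_sum fun k _ => ?_) le_rfl
  by_cases hk : k = i
  · subst hk
    simp only [Function.update_self, hR, cost_nil]
    exact (h.sized_buffer k).cost_nonneg hf
  · simp [hk]

/-! ### The potential function -/

/-- The cost yet to be paid for the flush in progress: its pending moves, and its log. -/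
noncomputable def flushCost (ε : ℝ) (f : ℕ → ℝ) : Option (Flush α) → ℝ
  | none => 0
  | some F => cost f F.moves + (2 * chargeRate ε + 1) * cost f F.log

/-- The potential of a layout and the flush in progress. -/
noncomputable def potential (ε : ℝ) (f : ℕ → ℝ) (D : Layout α) (o : Option (Flush α)) : ℝ :=
  chargeRate ε * D.bufferCost f + flushCost ε f o

/-- The moves and the log of the flush in progress have sizes at most `Δ`. -/
def FlushSized (Δ : ℕ) (o : Option (Flush α)) : Prop :=
  ∀ F ∈ o, Sized Δ F.moves ∧ Sized Δ F.log

theorem flushSized_none (Δ : ℕ) : FlushSized Δ (none : Option (Flush α)) := by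
  simp [FlushSized]

theorem Flush.settle_eq (F : Flush α) :
    F.settle = none ∧ F.moves = [] ∧ F.log = [] ∨ F.settle = some F := by
  unfold Flush.settle
  split_ifs with h
  · exact .inl ⟨rfl, by simpa using h.1, by simpa using h.2⟩
  · exact .inr rfl

theorem flushCost_settle (ε : ℝ) (f : ℕ → ℝ) (F : Flush α) :
    flushCost ε f F.settle = flushCost ε f (some F) := by
  rcases F.settle_eq with ⟨h1, h2, h3⟩ | h
  · simp [h1, flushCost, h2, h3]
  · rw [h]

theorem FlushSized.settle {Δ : ℕ} {F : Flush α} (h : FlushSized Δ (some F)) :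
    FlushSized Δ F.settle := by
  rcases F.settle_eq with ⟨h1, -, -⟩ | h1
  · rw [h1]; exact flushSized_none Δ
  · rwa [h1]

theorem FlushSized.bind_settle {Δ : ℕ} {o : Option (Flush α)} (h : FlushSized Δ o) :
    FlushSized Δ (o.bind Flush.settle) := by
  cases o with
  | none => exact h
  | some F => exact h.settle

theorem flushCost_bind_settle (ε : ℝ) (f : ℕ → ℝ) (o : Option (Flush α)) :
    flushCost ε f (o.bind Flush.settle) = flushCost ε f o := by
  cases o with
  | none => rfl
  | some F => exact flushCost_settle ε f F

/-- What an update of size `w`, leading from `D` to `D'` and possibly triggering a flush, guarantees. -/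
structure UpdateSpec (ε : ℝ) (f : ℕ → ℝ) (D : Layout α) (w : ℕ) (D' : Layout α)
    (o : Option (Flush α)) : Prop where
  good : D'.Good ε
  maxLen_eq : D'.maxLen = D.maxLen
  sized : FlushSized D.maxLen o
  log_eq : ∀ F ∈ o, F.log = []
  potential_le : potential ε f D' o ≤ chargeRate ε * D.bufferCost f + 2 * chargeRate ε * f w

section

variable {f : ℕ → ℝ} (hf : IsCostFunction f) {ε : ℝ} (hε : 0 < ε) (hε' : ε ≤ 1 / 2)
include hf hε hε'

theorem UpdateSpec.of_store {D D₁ : Layout α} {w : ℕ} (hw : 0 < w) (hG : D₁.Good ε)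
    (hm : D₁.maxLen = D.maxLen) (hc : D₁.bufferCost f ≤ D.bufferCost f + f w) :
    UpdateSpec ε f D w D₁ none := by
  refine ⟨hG, hm, flushSized_none _, by simp, ?_⟩
  have hK := one_le_chargeRate hε hε'
  have := hf.nonneg hw
  simp only [potential, flushCost]
  nlinarith

/-- The 2 in 2K f(w): an inserted trigger is counted once as a cell of the tail buffer and once more
as the trigger. -/
theorem UpdateSpec.of_startFlush {D D₁ : Layout α} {w : ℕ} (x : α) (v : ℕ) (hw : 0 < w)
    (hG : D₁.Good ε) (hm : D₁.maxLen = D.maxLen)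
    (hs : ∀ k, sizeClass w ≤ k → (D₁.region k).bufSpace < vol (D₁.region k).buffer + w)
    (hc : D₁.bufferCost f ≤ D.bufferCost f + f w) :
    UpdateSpec ε f D w (startFlush ε D₁ (sizeClass w) v).1
      (some (startFlush ε D₁ (sizeClass w) v).2) := by
  refine ⟨hG.target _, hm, ?_, ?_, ?_⟩
  · rintro F ⟨⟩
    exact ⟨hm ▸ startFlush_sized hG _ v, by intro c hc; simp [startFlush] at hc⟩
  · rintro F ⟨⟩
    rfl
  · have h1 := startFlush_cost_le hf hε hε' hG (x := x) v hw hs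
    have hK := one_le_chargeRate hε hε'
    have h2 := mul_le_mul_of_nonneg_left hc (zero_le_one.trans hK)
    have h3 : (startFlush ε D₁ (sizeClass w) v).2.log = [] := rfl
    simp only [potential, flushCost, h3, cost_nil]
    linarith

theorem insertObject_spec {D : Layout α} (h : D.Good ε) (x : α) {w : ℕ} (hw : 0 < w)
    (hm : w ≤ D.maxLen) :
    UpdateSpec ε f D w (insertObject ε D x w).1 (insertObject ε D x w).2.1 ∧
      (insertObject ε D x w).2.2.size = w := by
  have hfw := hf.nonneg hw
  unfold insertObject
  simp only
  split_ifs with hnew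
  · refine ⟨.of_store hf hε hε' hw ?_ rfl ?_, rfl⟩
    · exact h.newRegion (c := ⟨x, w, _, true⟩) hw hm (by simpa using hnew.1) hnew.2
    · have := h.bufferCost_newRegion_le hf (sizeClass w)
        (R := ⟨[⟨x, w, D.regionStart (sizeClass w), true⟩], w, [], ⌊ε * (w : ℝ)⌋₊⟩) rfl
      linarith
  · rcases hst : D.store x w true with _ | ⟨D', c⟩
    · have hs := h.store_none hw hst
      refine ⟨?_, rfl⟩
      refine .of_startFlush hf hε hε'
        (D₁ := { D with tail := D.tail ++ [⟨x, w, D.tailStart + vol D.tail, true⟩] }) x w hw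
        (h.append_tail _ hw hm hs) rfl hs ?_
      exact (Layout.bufferCost_append_tail D _ f).le
    · obtain ⟨h1, h2, h3, h4⟩ := h.store_some hw hm hst
      exact ⟨.of_store hf hε hε' hw h1 h2 (h4 f).le, h3⟩

variable [DecidableEq α]

theorem deleteObject_spec {D : Layout α} (h : D.Good ε) (x : α) {w : ℕ} (hw : 0 < w)
    (hm : w ≤ D.maxLen) :
    UpdateSpec ε f D w (deleteObject ε D x w).1 (deleteObject ε D x w).2 := by
  have hr := h.remove x
  have hcost := D.bufferCost_remove x f
  have hfw := hf.nonneg hw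
  unfold deleteObject
  rcases hst : (D.remove x).store x w false with _ | ⟨D', c⟩
  · exact .of_startFlush hf hε hε' x 0 hw hr rfl (hr.store_none hw hst) (by linarith)
  · obtain ⟨h1, h2, h3, h4⟩ := hr.store_some hw hm hst
    exact .of_store hf hε hε' hw h1 h2 (by rw [h4, hcost])

end

/-! ### The steps of a flush -/

/-- An upper bound for the cost of the steps that can still be performed in the present request, when
the volume `done` has been processed. -/
noncomputable def allowance (f : ℕ → ℝ) (Δ : ℕ) (budget : ℝ) (done : ℕ) : ℝ :=
  if (done : ℝ) ≤ budget then f 1 * (budget - done) + f Δ else 0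

theorem allowance_nonneg {f : ℕ → ℝ} (hf : IsCostFunction f) {Δ : ℕ} (hΔ : 0 < Δ) (budget : ℝ)
    (done : ℕ) : 0 ≤ allowance f Δ budget done := by
  unfold allowance
  have h1 := hf.nonneg one_pos
  have h2 := hf.nonneg hΔ
  split_ifs with h
  · have := mul_nonneg h1 (sub_nonneg.2 h)
    linarith
  · exact le_rfl

/-- If the budget is not yet exceeded after the step, f(w) ≤ w f(1) is charged to the budget.
Otherwise the step is the last one and uses up the reserved f(Δ). -/
theorem add_allowance_le {f : ℕ → ℝ} (hf : IsCostFunction f) {Δ w : ℕ} (hw : 0 < w) (hΔ : w ≤ Δ)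
    {budget : ℝ} {done : ℕ} (h : (done : ℝ) ≤ budget) :
    f w + allowance f Δ budget (done + w) ≤ allowance f Δ budget done := by
  unfold allowance
  have h1 := hf.nonneg one_pos
  have h2 := hf.mono w Δ hw hΔ
  have h3 := hf.le_mul_one hw
  rw [if_pos h]
  split_ifs
  · push_cast
    linarith
  · have := mul_nonneg h1 (sub_nonneg.2 h)
    linarith

section

variable [DecidableEq α]

theorem runMoves_spec {f : ℕ → ℝ} (hf : IsCostFunction f) {ε : ℝ} (budget : ℝ) (done : ℕ)
    (D : Layout α) (ms : List (Cell α)) (h : D.Good ε) (hs : Sized D.maxLen ms) :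
    (runMoves budget done D ms).2.1.Good ε ∧
    (runMoves budget done D ms).2.1.maxLen = D.maxLen ∧
    (runMoves budget done D ms).2.1.bufferCost f = D.bufferCost f ∧
    Sized D.maxLen (runMoves budget done D ms).2.2.1 ∧
    cost f (runMoves budget done D ms).2.2.1 + cost f (runMoves budget done D ms).2.2.2
      = cost f ms ∧
    cost f (runMoves budget done D ms).2.2.2
        + allowance f D.maxLen budget (runMoves budget done D ms).1
      ≤ allowance f D.maxLen budget done := by
  induction ms generalizing done D with
  | nil => exact ⟨h, rfl, rfl, hs, by simp [runMoves], by simp [runMoves]⟩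
  | cons m ms ih =>
    rw [runMoves]
    split_ifs with hd
    · obtain ⟨h1, h2, h3, h4, h5, h6⟩ := ih (done + m.size) (D.relocate m) (h.relocate m)
        (hs.subset (by simp))
      have hm := hs m (by simp)
      have h7 := add_allowance_le hf hm.1 hm.2 hd
      refine ⟨h1, h2, h3.trans (D.bufferCost_relocate m f), h4, ?_, ?_⟩
      · simp only [cost_cons]
        linarith
      · have : (D.relocate m).maxLen = D.maxLen := rfl
        rw [this] at h6
        simp only [cost_cons]
        linarith
    · exact ⟨h, rfl, rfl, hs, by simp, by simp⟩

variable {f : ℕ → ℝ} (hf : IsCostFunction f) {ε : ℝ} (hε : 0 < ε) (hε' : ε ≤ 1 / 2)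
include hf hε hε'

/-- The weight 2K + 1 of a log entry pays for its update (2K) and for rewriting the object (1).
Delete records write nothing but consume budget as well. -/
theorem runLog_spec (budget : ℝ) (logEnd done : ℕ) (D : Layout α) (log : List (Cell α))
    (h : D.Good ε) (hs : Sized D.maxLen log) (hΔ : 0 < D.maxLen) :
    (runLog ε budget logEnd done D log).1.Good ε ∧
    (runLog ε budget logEnd done D log).1.maxLen = D.maxLen ∧
    FlushSized D.maxLen (runLog ε budget logEnd done D log).2.1 ∧
    potential ε f (runLog ε budget logEnd done D log).1 (runLog ε budget logEnd done D log).2.1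
        + cost f (runLog ε budget logEnd done D log).2.2
      ≤ potential ε f D (some ⟨[], log, logEnd⟩) ∧
    cost f (runLog ε budget logEnd done D log).2.2 ≤ allowance f D.maxLen budget done := by
  induction log generalizing done D with
  | nil =>
    refine ⟨h, rfl, flushSized_none _, ?_, ?_⟩
    · simp [runLog, potential, flushCost]
    · simpa [runLog] using allowance_nonneg hf hΔ budget done
  | cons c cs ih =>
    obtain ⟨hc0, hcΔ⟩ := hs c (by simp)
    have hcs : Sized D.maxLen cs := hs.subset (by simp)
    have hfc := hf.nonneg hc0
    rw [runLog]
    by_cases hd : (done : ℝ) ≤ budget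
    · rw [if_pos hd]
      have hadd := add_allowance_le hf hc0 hcΔ hd
      dsimp only
      generalize hrr : (if c.live = true then ((insertObject ε D c.name c.size).1,
          (insertObject ε D c.name c.size).2.1, [(insertObject ε D c.name c.size).2.2])
        else ((deleteObject ε D c.name c.size).1, (deleteObject ε D c.name c.size).2, []) :
          Layout α × Option (Flush α) × List (Cell α)) = r
      have hr : UpdateSpec ε f D c.size r.1 r.2.1 ∧ cost f r.2.2 ≤ f c.size := by
        by_cases hl : c.live = true
        · have := insertObject_spec hf hε hε' h c.name hc0 hcΔ
          rw [← hrr, if_pos hl]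
          exact ⟨this.1, by simp [this.2]⟩
        · have := deleteObject_spec hf hε hε' h c.name hc0 hcΔ
          rw [← hrr, if_neg hl]
          exact ⟨this, by simpa using hfc⟩
      clear hrr
      obtain ⟨D₁, o, ws⟩ := r
      obtain ⟨hr, hws⟩ := hr
      simp only at hr hws
      have hpot := hr.potential_le
      cases o with
      | none =>
        obtain ⟨h1, h2, h3, h4, h5⟩ := ih (done + c.size) D₁ hr.good (hr.maxLen_eq ▸ hcs)
          (hr.maxLen_eq ▸ hΔ)
        rw [hr.maxLen_eq] at h2 h3 h5
        refine ⟨h1, h2, h3, ?_, ?_⟩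
        · simp only [potential, flushCost, cost_append, cost_nil, cost_cons] at h4 hpot ⊢
          linarith
        · simp only [cost_append]
          linarith
      -- The new flush inherits the unprocessed entries with their potential, and no further step is
      -- made, so the present write alone has to fit into the allowance.
      | some F =>
        have hlog := hr.log_eq F rfl
        have hFs := hr.sized F rfl
        refine ⟨hr.good, hr.maxLen_eq, ?_, ?_, ?_⟩
        · refine FlushSized.settle ?_
          rintro F' ⟨⟩
          exact ⟨hFs.1, hcs⟩
        · simp only [potential, flushCost_settle]
          simp only [potential, flushCost, hlog, cost_nil, cost_cons] at hpot ⊢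
          linarith
        · have := allowance_nonneg hf hΔ budget (done + c.size)
          simp only
          linarith
    · rw [if_neg hd]
      refine ⟨h, rfl, ?_, by simp, ?_⟩
      · rintro F ⟨⟩
        exact ⟨by intro d hd; simp at hd, hs⟩
      · simpa using allowance_nonneg hf hΔ budget done

theorem work_spec (budget : ℝ) (D : Layout α) (F : Flush α) (h : D.Good ε)
    (hs : FlushSized D.maxLen (some F)) (hΔ : 0 < D.maxLen) :
    (work ε budget D F).1.Good ε ∧
    (work ε budget D F).1.maxLen = D.maxLen ∧
    FlushSized D.maxLen (work ε budget D F).2.1 ∧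
    potential ε f (work ε budget D F).1 (work ε budget D F).2.1 + cost f (work ε budget D F).2.2
      ≤ potential ε f D (some F) ∧
    cost f (work ε budget D F).2.2 ≤ allowance f D.maxLen budget 0 := by
  obtain ⟨hm, hl⟩ := hs F rfl
  obtain ⟨h1, h2, h3, h4, h5, h6⟩ := runMoves_spec hf budget 0 D F.moves h hm
  unfold work
  extract_lets r
  change Layout.Good ε r.2.1 at h1
  change r.2.1.maxLen = _ at h2
  change r.2.1.bufferCost f = _ at h3
  change Sized _ r.2.2.1 at h4
  change cost f r.2.2.1 + cost f r.2.2.2 = _ at h5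
  change cost f r.2.2.2 + allowance f D.maxLen budget r.1 ≤ _ at h6
  clear_value r
  obtain ⟨done, D₁, ms, made⟩ := r
  simp only at h1 h2 h3 h4 h5 h6 ⊢
  split_ifs with he
  · have hms : ms = [] := by simpa using he
    subst hms
    obtain ⟨g1, g2, g3, g4, g5⟩ := runLog_spec hf hε hε' budget F.logEnd done D₁ F.log h1
      (h2 ▸ hl) (h2 ▸ hΔ)
    rw [h2] at g2 g3 g5
    refine ⟨g1, g2, g3, ?_, ?_⟩
    · simp only [potential, flushCost, cost_append, cost_nil, h3] at g4 h5 ⊢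
      linarith
    · rw [cost_append]
      linarith
  · refine ⟨h1, h2, ?_, ?_, ?_⟩
    · rintro F' ⟨⟩
      exact ⟨h4, hl⟩
    · simp only [potential, flushCost, h3]
      linarith
    · have := allowance_nonneg hf hΔ budget done
      linarith

end

/-! ### Serving requests -/

/-- The invariant of the reallocator. -/
structure State.Inv (ε : ℝ) (S : State α) : Prop where
  good : S.layout.Good ε
  sized : FlushSized S.layout.maxLen S.flush
  table_sized : ∀ x w, S.table x = some w → 0 < w ∧ w ≤ S.layout.maxLen

theorem State.init_inv (ε : ℝ) : (State.init : State α).Inv ε where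
  good := by
    constructor <;> simp [State.init, Sized]
  sized := flushSized_none _
  table_sized := by simp [State.init]

theorem State.Inv.potential_nonneg {f : ℕ → ℝ} (hf : IsCostFunction f) {ε : ℝ} (hε : 0 < ε)
    (hε' : ε ≤ 1 / 2) {S : State α} (h : S.Inv ε) : 0 ≤ potential ε f S.layout S.flush := by
  have hK := one_le_chargeRate hε hε'
  refine add_nonneg (mul_nonneg (by linarith) (h.good.bufferCost_nonneg hf)) ?_
  rcases hF : S.flush with _ | F
  · exact le_rfl
  · obtain ⟨h1, h2⟩ := h.sized F hF
    exact add_nonneg (h1.cost_nonneg hf) (mul_nonneg (by linarith) (h2.cost_nonneg hf))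

theorem potential_init (ε : ℝ) (f : ℕ → ℝ) :
    potential ε f (State.init : State α).layout (State.init : State α).flush = 0 := by
  simp [State.init, potential, flushCost, Layout.bufferCost]

theorem sum_le_sum_of_potential {n : ℕ} {c a : Fin n → ℝ} (Φ : ℕ → ℝ) (h₀ : Φ 0 = 0)
    (h₁ : 0 ≤ Φ n) (h : ∀ t : Fin n, c t + Φ (t + 1) ≤ Φ t + a t) : ∑ t, c t ≤ ∑ t, a t := by
  have key : ∀ t, c t ≤ a t + (Φ t - Φ (t + 1)) := fun t => by linarith [h t]
  refine (Finset.sum_le_sum fun t _ => key t).trans ?_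
  rw [Finset.sum_add_distrib, Fin.sum_univ_eq_sum_range (fun t => Φ t - Φ (t + 1)),
    Finset.sum_range_sub']
  linarith

theorem longest_append (σ : List (Request α)) (r : Request α) :
    longest (σ ++ [r]) = max (longest σ) (longest [r]) := by
  induction σ with
  | nil => simp [longest]
  | cons q σ ih => cases q <;> simp [longest, ih, max_assoc]

variable [DecidableEq α]

/-- What serving a request with the object length `w` guarantees. -/
structure ServeSpec (ε : ℝ) (f : ℕ → ℝ) (S : State α) (r : Request α) (w : ℕ) (S' : State α)
    (ws : List (Cell α)) : Prop where
  inv : S'.Inv ε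
  table_eq : S'.table = r.apply S.table
  maxLen_eq : S'.layout.maxLen = max S.layout.maxLen (longest [r])
  len_pos : 0 < w
  len_le : w ≤ S'.layout.maxLen
  amortized : cost f ws + potential ε f S'.layout S'.flush
    ≤ potential ε f S.layout S.flush + (2 * chargeRate ε + 2) * f w
  worst_case : cost f ws ≤ f w + allowance f S'.layout.maxLen (4 / ε * w) 0

/-- In 2K + 2, one unit pays for the initial write and the rest is the log weight 2K + 1. Without a
flush in progress, 2K + 1 would suffice. -/
theorem serve_spec {f : ℕ → ℝ} (hf : IsCostFunction f) {ε : ℝ} (hε : 0 < ε) (hε' : ε ≤ 1 / 2)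
    {S : State α} (h : S.Inv ε) {r : Request α} (hr : r.Legal S.table) :
    ServeSpec ε f S r (r.len S.table) (serve ε S r).1 (serve ε S r).2 := by
  have hK := one_le_chargeRate hε hε'
  cases r with
  | insert x w =>
    obtain ⟨hw, -⟩ := hr
    have hw0 : 0 < w := hw
    have hfw := hf.nonneg hw0
    have hKw : 0 ≤ chargeRate ε * f w := mul_nonneg (zero_le_one.trans hK) hfw
    change ServeSpec ε f S (Request.insert x w) w _ _
    unfold serve
    dsimp only
    set Δ := max S.layout.maxLen w with hΔ
    set D : Layout α := { S.layout with maxLen := Δ } with hD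
    have hΔ' : Δ = max S.layout.maxLen (longest [Request.insert x w]) := by simp [hΔ, longest]
    have hG : D.Good ε := h.good.withMaxLen (le_max_left S.layout.maxLen w)
    have hbc : D.bufferCost f = S.layout.bufferCost f := h.good.bufferCost_withMaxLen (le_max_left _ _) f
    have hwΔ : w ≤ Δ := le_max_right _ _
    have htab : ∀ y v, (Request.insert x w).apply S.table y = some v → 0 < v ∧ v ≤ Δ := by
      intro y v hy
      by_cases hyx : y = x
      · subst hyx
        simp only [Request.apply, Function.update_self, Option.some.injEq] at hy
        omega
      · simp only [Request.apply, Function.update_of_ne hyx] at hy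
        exact ⟨(h.table_sized y v hy).1, (h.table_sized y v hy).2.trans (le_max_left _ _)⟩
    have hDm : D.maxLen = Δ := rfl
    clear_value D
    rcases hF : S.flush with _ | F
    · have hsp := insertObject_spec hf hε hε' hG x hw0 (hDm ▸ hwΔ)
      dsimp only
      generalize insertObject ε D x w = q at hsp
      obtain ⟨D₁, o, c⟩ := q
      obtain ⟨hsp, hc⟩ := hsp
      simp only at hsp hc ⊢
      have hm : D₁.maxLen = Δ := hsp.maxLen_eq.trans hDm
      have hpot := hsp.potential_le
      refine ⟨⟨hsp.good, ?_, ?_⟩, rfl, ?_, hw0, ?_, ?_, ?_⟩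
      · simp only
        rw [hsp.maxLen_eq]
        exact hsp.sized.bind_settle
      · simpa only [hm] using htab
      · exact hm.trans hΔ'
      · exact hm ▸ hwΔ
      · simp only [potential, flushCost_bind_settle, hF]
        simp only [potential, hbc, flushCost] at hpot ⊢
        simp only [cost_cons, cost_nil, hc]
        linarith
      · have := allowance_nonneg hf (hw0.trans_le hwΔ) (4 / ε * w) 0
        simp only [cost_cons, cost_nil, hc, hm]
        linarith
    · have hs := h.sized F hF
      have hle : S.layout.maxLen ≤ D.maxLen := hDm ▸ le_max_left _ _
      have hsp := work_spec hf hε hε' (4 / ε * w) D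
        { F with log := F.log ++ [⟨x, w, F.logEnd, true⟩], logEnd := F.logEnd + w } hG
        (by
          rintro F' ⟨⟩
          exact ⟨hs.1.mono hle, (hs.2.mono hle).append (.singleton hw0 (hDm ▸ hwΔ))⟩)
        (hDm ▸ hw0.trans_le hwΔ)
      dsimp only
      generalize work ε (4 / ε * w) D _ = q at hsp
      obtain ⟨D₁, o, ws⟩ := q
      obtain ⟨h1, h2, h3, h4, h5⟩ := hsp
      simp only at h1 h2 h3 h4 h5 ⊢
      have hm : D₁.maxLen = Δ := h2.trans hDm
      refine ⟨⟨h1, ?_, ?_⟩, rfl, ?_, hw0, ?_, ?_, ?_⟩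
      · simp only
        rw [h2]
        exact h3
      · simpa only [hm] using htab
      · exact hm.trans hΔ'
      · exact hm ▸ hwΔ
      · rw [hF]
        simp only [potential, flushCost, hbc, cost_append, cost_cons, cost_nil] at h4 ⊢
        linarith
      · simp only [cost_cons, hm]
        rw [hDm] at h5
        linarith
  | delete x =>
    obtain ⟨w, hxw⟩ := Option.ne_none_iff_exists'.1 hr
    obtain ⟨hw0, hwΔ⟩ := h.table_sized x w hxw
    have hfw := hf.nonneg hw0
    have hKw : 0 ≤ chargeRate ε * f w := mul_nonneg (zero_le_one.trans hK) hfw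
    have hlen : (Request.delete x).len S.table = w := by simp [Request.len, hxw]
    have hgetD : (S.table x).getD 0 = w := by simp [hxw]
    have hΔ' : S.layout.maxLen = max S.layout.maxLen (longest [Request.delete x]) := by
      simp [longest]
    have htab : ∀ y v, (Request.delete x).apply S.table y = some v →
        0 < v ∧ v ≤ S.layout.maxLen := by
      intro y v hy
      by_cases hyx : y = x
      · subst hyx
        simp [Request.apply] at hy
      · simp only [Request.apply, Function.update_of_ne hyx] at hy
        exact h.table_sized y v hy
    rw [hlen]
    unfold serve
    dsimp only
    rw [hgetD]
    rcases hF : S.flush with _ | F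
    · have hsp := deleteObject_spec hf hε hε' h.good x hw0 hwΔ
      dsimp only
      generalize deleteObject ε S.layout x w = q at hsp
      obtain ⟨D₁, o⟩ := q
      simp only at hsp ⊢
      have hm := hsp.maxLen_eq
      have hpot := hsp.potential_le
      refine ⟨⟨hsp.good, ?_, ?_⟩, rfl, ?_, hw0, ?_, ?_, ?_⟩
      · simp only
        rw [hm]
        exact hsp.sized.bind_settle
      · simpa only [hm] using htab
      · exact hm.trans hΔ'
      · exact hm ▸ hwΔ
      · simp only [potential, flushCost_bind_settle, hF]
        simp only [potential, flushCost] at hpot ⊢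
        simp only [cost_nil]
        linarith
      · have := allowance_nonneg hf (hw0.trans_le hwΔ) (4 / ε * w) 0
        simp only [cost_nil, hm]
        linarith
    · have hs := h.sized F hF
      have hsp := work_spec hf hε hε' (4 / ε * w) S.layout
        { F with log := F.log ++ [⟨x, w, F.logEnd, false⟩], logEnd := F.logEnd + w } h.good
        (by
          rintro F' ⟨⟩
          exact ⟨hs.1, hs.2.append (.singleton hw0 hwΔ)⟩)
        (hw0.trans_le hwΔ)
      dsimp only
      generalize work ε (4 / ε * w) S.layout _ = q at hsp
      obtain ⟨D₁, o, ws⟩ := q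
      obtain ⟨h1, h2, h3, h4, h5⟩ := hsp
      simp only at h1 h2 h3 h4 h5 ⊢
      refine ⟨⟨h1, ?_, ?_⟩, rfl, ?_, hw0, ?_, ?_, ?_⟩
      · simp only
        rw [h2]
        exact h3
      · simpa only [h2] using htab
      · exact h2.trans hΔ'
      · exact h2 ▸ hwΔ
      · rw [hF]
        simp only [potential, flushCost, cost_append, cost_cons, cost_nil] at h4 ⊢
        linarith
      · simp only [h2]
        linarith

/-! ### Executions -/

theorem stateAfter_append (ε : ℝ) (σ : List (Request α)) (r : Request α) :
    stateAfter ε (σ ++ [r]) = (serve ε (stateAfter ε σ) r).1 := by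
  rw [stateAfter, List.foldl_append]
  rfl

theorem active_append (σ : List (Request α)) (r : Request α) :
    active (σ ++ [r]) = r.apply (active σ) := by
  rw [active, List.foldl_append]
  rfl

theorem stateAfter_spec {ε : ℝ} (hε : 0 < ε) (hε' : ε ≤ 1 / 2) {σ : List (Request α)}
    (hσ : IsExecution σ) (t : ℕ) (ht : t ≤ σ.length) :
    (stateAfter ε (σ.take t)).Inv ε ∧ (stateAfter ε (σ.take t)).table = active (σ.take t) ∧
      (stateAfter ε (σ.take t)).layout.maxLen = longest (σ.take t) := by
  induction t with
  | zero => exact ⟨State.init_inv ε, rfl, rfl⟩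
  | succ t ih =>
    obtain ⟨h1, h2, h3⟩ := ih (by omega)
    have hl := hσ t ht
    rw [← h2] at hl
    -- The invariant, the table and Δ do not depend on the cost function, so any one will do.
    have hsp := serve_spec (f := fun _ => 0) ⟨by simp, by simp⟩ hε hε' h1 hl
    have e : σ.take (t + 1) = σ.take t ++ [σ[t]] := by simp
    rw [e, stateAfter_append, active_append, longest_append]
    exact ⟨hsp.inv, by rw [hsp.table_eq, h2], by rw [hsp.maxLen_eq, h3]⟩

theorem request_spec {f : ℕ → ℝ} (hf : IsCostFunction f) {ε : ℝ} (hε : 0 < ε) (hε' : ε ≤ 1 / 2)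
    {σ : List (Request α)} (hσ : IsExecution σ) (t : ℕ) (ht : t < σ.length) :
    ServeSpec ε f (stateAfter ε (σ.take t)) σ[t] (σ[t].len (active (σ.take t)))
      (stateAfter ε (σ.take (t + 1))) (serve ε (stateAfter ε (σ.take t)) σ[t]).2 := by
  obtain ⟨h1, h2, -⟩ := stateAfter_spec hε hε' hσ t ht.le
  have hl := hσ t ht
  rw [← h2] at hl
  have e : σ.take (t + 1) = σ.take t ++ [σ[t]] := by simp
  rw [e, stateAfter_append, ← h2]
  exact serve_spec hf hε hε' h1 hl

theorem requestCost_le {f : ℕ → ℝ} (hf : IsCostFunction f) {ε : ℝ} (hε : 0 < ε)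
    (hε' : ε ≤ 1 / 2) {σ : List (Request α)} (hσ : IsExecution σ) (t : ℕ) (ht : t < σ.length) :
    requestCost ε f (σ.take t) σ[t]
      ≤ 4 * ((1 / ε) * (σ[t].len (active (σ.take t)) : ℝ) * f 1)
        + 2 * f (longest (σ.take (t + 1))) := by
  have hsp := request_spec hf hε hε' hσ t ht
  have hΔ := (stateAfter_spec hε hε' hσ (t + 1) ht).2.2
  have h1 := hsp.worst_case
  have h2 := hf.mono _ _ hsp.len_pos hsp.len_le
  rw [allowance, if_pos (by rw [Nat.cast_zero]; positivity)] at h1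
  rw [hΔ] at h1 h2
  refine h1.trans ?_
  rw [Nat.cast_zero]
  have e : f 1 * (4 / ε * (σ[t].len (active (σ.take t)) : ℝ) - 0)
      = 4 * ((1 / ε) * (σ[t].len (active (σ.take t)) : ℝ) * f 1) := by ring
  linarith

end StorageReallocation

/-! ### The amortized and worst-case bounds -/

theorem mainTheorem6 :
    ∃ C : ℝ, 0 < C ∧
      ∀ (α : Type*) [DecidableEq α] (ε : ℝ), 0 < ε → ε ≤ 1 / 2 →
      ∀ f : ℕ → ℝ, StorageReallocation.IsCostFunction f →
      ∀ σ : List (StorageReallocation.Request α), StorageReallocation.IsExecution σ →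
        -- amortized cost
        (∑ t : Fin σ.length, StorageReallocation.requestCost ε f (σ.take t) σ[t]
          ≤ ∑ t : Fin σ.length,
              C * (f (σ[t].len (StorageReallocation.active (σ.take t)))
                * ((1 / ε) * Real.logb 2 (1 / ε)))) ∧
        -- worst-case cost of each request
        (∀ t : Fin σ.length,
          StorageReallocation.requestCost ε f (σ.take t) σ[t]
            ≤ C * ((1 / ε) * (σ[t].len (StorageReallocation.active (σ.take t)) : ℝ) * f 1
                + f (StorageReallocation.longest (σ.take (t + 1))))) := by
  open StorageReallocation in
  -- 124 = 2 · 61 + 2: the amortized charge is 2K + 2, and (1/ε) lg(1/ε) ≥ 1 absorbs the last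
  -- summand. The worst case needs only 4.
  refine ⟨124, by norm_num, fun α _ ε hε hε' f hf σ hσ => ⟨?_, fun t => ?_⟩⟩
  · refine sum_le_sum_of_potential
      (fun t => potential ε f (stateAfter ε (σ.take t)).layout (stateAfter ε (σ.take t)).flush)
      (potential_init ε f)
      ((stateAfter_spec hε hε' hσ σ.length le_rfl).1.potential_nonneg hf hε hε') fun t => ?_
    refine (request_spec hf hε hε' hσ t t.2).amortized.trans (add_le_add le_rfl ?_)
    have h0 : 0 ≤ f (σ[t].len (active (σ.take t))) :=
      hf.nonneg (request_spec hf hε hε' hσ t t.2).len_pos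
    have h1 := one_le_logb hε hε'
    have h2 := two_le_one_div hε hε'
    have h3 : 2 * chargeRate ε + 2 ≤ 124 * ((1 / ε) * Real.logb 2 (1 / ε)) := by
      unfold chargeRate
      nlinarith
    refine (mul_le_mul_of_nonneg_right h3 h0).trans_eq ?_
    ring
  · have h1 := requestCost_le hf hε hε' hσ t t.2
    have hsp := request_spec hf hε hε' hσ t t.2
    have hΔ := (stateAfter_spec hε hε' hσ (t + 1) t.2).2.2
    have h2 : 0 ≤ f (longest (σ.take (t + 1))) :=
      hf.nonneg (hΔ ▸ hsp.len_pos.trans_le hsp.len_le)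
    have h3 : 0 ≤ (1 / ε) * (σ[t].len (active (σ.take t)) : ℝ) * f 1 := by
      have := hf.nonneg one_pos
      positivity
    refine h1.trans ?_
    simp only [Fin.getElem_fin] at h3 ⊢
    linarith
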